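/- Let $j=\begin{pmatrix}-1&0\\0&1\end{pmatrix}$ and let $S\subset\mathbb R$ be an interval containing $0$. For each $z\in\mathbb C$ and $\ell\in S$ let $\mathfrak A(z,\ell)$ be a complex $2\times2$ matrix such that: - (continuity) $\ell\mapsto\mathfrak A(z,\ell)$ is continuous on $S$ for every $z$; - ($j$-monotonicity) for all $\ell_1<\ell_2$ in $S$, the function $C(z)=\mathfrak A(z,\ell_1)^{-1}\mathfrak A(z,\ell_2)$ is entire, with $j-C(z)jC(z)^*\ge0$ for $\operatorname{Im}z>0$ and $j-C(z)jC(z)^*=0$ for $z\in\mathbb R$; - (A-gauge) for every $\ell\in S$, $\mathfrak A(i,\ell)$ is lower triangular with positive diagonal entries; - $\det\mathfrak A(z,\ell)=1$ for all $z,\ell$, and $\mathfrak A(z,0)=I$ for all $z$. Then: (a) $\mathfrak A$ is the solution of a canonical system in A-gauge: there are a positive Borel measure $\mu$ on $S$ without atoms, finite on compact subintervals of $S$, and a locally $\mu$-integrable function $\mathfrak a:S\to\mathbb C$ with $|\mathfrak a|\le1$ $\mu$-a.e., such that, with $$A=\begin{pmatrix}1&-\overline{\mathfrak a}\\-\mathfrak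 a&1\end{pmatrix}\ge0,\qquad B=\begin{pmatrix}0&\overline{\mathfrak a}\\-\mathfrak a&0\end{pmatrix}=-B^*,$$ $$\mathfrak A(z,\ell)j=j+\int_0^\ell\mathfrak A(z,l)\bigl(izA(l)-B(l)\bigr)\,d\mu(l),\qquad z\in\mathbb C,\ \ell\in S.$$ Moreover, the following hold for every pair $(\mu,\mathfrak a)$ as in (a), where $\mu(\ell)$ denotes the distribution function of $\mu$ normalized by $\mu(0)=0$, so that $\mu([\ell_1,\ell_2))=\mu(\ell_2)-\mu(\ell_1)$ for $\ell_1\le\ell_2$ in $S$: (b) $\mathfrak A_{22}(i,\ell)$ is a (weakly) decreasing function of $\ell\in S$, and $$\mu(\ell)=\log\mathfrak A_{11}(i,\ell)=-\log\mathfrak A_{22}(i,\ell),\qquad \ell\in S.$$ (c) $\mathfrak A(i,\cdot)$ is locally absolutely continuous with respect to $\mu$, and its Radon–Nikodym derivative $\partial_\mu\mathfrak A(i,\cdot)$ satisfies $$A(\ell)+B(\ell)=\begin{pmatrix}1&0\\-2\mathfrak a(\ell)&1\end{pmatrix}=-\mathfrak A(i,\ell)^{-1}\,\partial_\mu\mathfrak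 A(i,\ell)\,j\qquad\text{for }\mu\text{-a.e. }\ell.$$ Moreover, $|\mathfrak a(\ell)|\le1$ for $\mu$-a.e. $\ell$. (d) For every $\ell\in S$, $$\mathfrak A(i,\ell)=\begin{pmatrix}e^{\mu(\ell)}&0\\-e^{\mu(\ell)}\kappa(\ell)&e^{-\mu(\ell)}\end{pmatrix},\qquad \kappa(\ell)=\int_0^\ell2\mathfrak a(l)e^{-2\mu(l)}\,d\mu(l).$$ -/

import Mathlib

open scoped ComplexOrder Matrix

noncomputable section

namespace Arov

/-- Complex `2 × 2` matrices. -/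
abbrev Mat2 : Type := Matrix (Fin 2) (Fin 2) ℂ

/-- The signature matrix `j = diag(-1, 1)`. -/
def jMat : Mat2 := !![-1, 0; 0, 1]

/-- An entire matrix function `A` is `J`-inner if `J - A(z) J A(z)* ≥ 0` for `Im z > 0`,
with equality to zero for real `z`. -/
structure IsJInner (J : Mat2) (A : ℂ → Mat2) : Prop where
  entire : ∀ i k, Differentiable ℂ fun z => A z i k
  contractive : ∀ z : ℂ, 0 < z.im → (J - A z * J * (A z)ᴴ).PosSemidef
  unitary : ∀ x : ℝ, J - A x * J * (A x)ᴴ = 0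

/-- The family `A(z, t)`, `t ∈ S`, is `J`-monotonic if `A(z, t₁)⁻¹ A(z, t₂)` is `J`-inner
whenever `t₁ < t₂`. -/
def IsJMonotonic (J : Mat2) (S : Set ℝ) (A : ℂ → ℝ → Mat2) : Prop :=
  ∀ t₁ ∈ S, ∀ t₂ ∈ S, t₁ < t₂ → IsJInner J fun z => (A z t₁)⁻¹ * A z t₂

/-- Continuity of the family in the parameter `t ∈ S`, for each fixed `z`. -/
def IsContinuousFamily (S : Set ℝ) (A : ℂ → ℝ → Mat2) : Prop :=
  ∀ z, ContinuousOn (fun t => A z t) S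

/-- Arov gauge: at `z = i` the matrices are lower triangular with positive diagonal entries
(`0 < w` for a complex number `w` means that `w` is real and positive). -/
def InArovGauge (S : Set ℝ) (A : ℂ → ℝ → Mat2) : Prop :=
  ∀ t ∈ S, A Complex.I t 0 1 = 0 ∧ 0 < A Complex.I t 0 0 ∧ 0 < A Complex.I t 1 1

/-- A matrix function is locally `ν`-integrable on `S`: every entry is integrable on every
compact interval with end points in `S`. -/
def LocInt (S : Set ℝ) (ν : MeasureTheory.Measure ℝ) (F : ℝ → Mat2) : Prop :=
  ∀ a ∈ S, ∀ b ∈ S, ∀ i k, MeasureTheory.IntegrableOn (fun t => F t i k) (Set.Icc a b) ν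

/-- The entrywise oriented integral `∫ₐᵇ F dν` of a matrix function. -/
def matIntegral (ν : MeasureTheory.Measure ℝ) (F : ℝ → Mat2) (a b : ℝ) : Mat2 :=
  Matrix.of fun i k => ∫ t in a..b, F t i k ∂ν

/-- Coefficients `(ν, P, Q)` of a canonical system on the interval `S`: `ν` is a continuous
positive Borel measure on `S` (viewed as a measure on `ℝ` carried by `S`), finite on compact
subintervals of `S`; `P, Q` are locally integrable with `P ≥ 0`, `Q = -Q*` and
`tr (jP) = tr (jQ) = 0` almost everywhere. -/
structure IsCanonicalSystem (S : Set ℝ) (ν : MeasureTheory.Measure ℝ) (P Q : ℝ → Mat2) :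
    Prop where
  carried : ν Sᶜ = 0
  continuous : ∀ t, ν {t} = 0
  finite : ∀ a ∈ S, ∀ b ∈ S, ν (Set.Icc a b) < ⊤
  locInt_P : LocInt S ν P
  locInt_Q : LocInt S ν Q
  nonneg : ∀ᵐ t ∂ν, (P t).PosSemidef
  skew : ∀ᵐ t ∂ν, Q t = -(Q t)ᴴ
  trace_P : ∀ᵐ t ∂ν, (jMat * P t).trace = 0
  trace_Q : ∀ᵐ t ∂ν, (jMat * Q t).trace = 0

/-- The coefficients are in Arov gauge: `P + Q` is lower triangular and `tr Q = 0` a.e. -/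
def CoeffInArovGauge (ν : MeasureTheory.Measure ℝ) (P Q : ℝ → Mat2) : Prop :=
  ∀ᵐ t ∂ν, (P t + Q t) 0 1 = 0 ∧ (Q t).trace = 0

/-- `A` solves the canonical system on `S`:
`A(z,t) j = j + ∫₀ᵗ A(z,ξ) (i z P(ξ) - Q(ξ)) dν(ξ)` for all `z ∈ ℂ`, `t ∈ S`,
with locally integrable integrand. -/
def SolvesCanonicalSystem (S : Set ℝ) (ν : MeasureTheory.Measure ℝ) (P Q : ℝ → Mat2)
    (A : ℂ → ℝ → Mat2) : Prop :=
  ∀ z : ℂ,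
    LocInt S ν (fun ξ => A z ξ * ((Complex.I * z) • P ξ - Q ξ)) ∧
    ∀ t ∈ S, A z t * jMat =
      jMat + matIntegral ν (fun ξ => A z ξ * ((Complex.I * z) • P ξ - Q ξ)) 0 t

/-- The coefficient `A` attached to the parameter `𝔞`. -/
def coeffA (𝔞 : ℝ → ℂ) (t : ℝ) : Mat2 := !![1, -star (𝔞 t); -𝔞 t, 1]

/-- The coefficient `B` attached to the parameter `𝔞`. -/
def coeffB (𝔞 : ℝ → ℂ) (t : ℝ) : Mat2 := !![0, star (𝔞 t); -𝔞 t, 0]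

/-- The family `𝔄` is the solution on `S` of the canonical system in Arov gauge with
parameters `(μ, 𝔞)`. -/
structure IsArovSolution (S : Set ℝ) (μ : MeasureTheory.Measure ℝ) (𝔞 : ℝ → ℂ)
    (𝔄 : ℂ → ℝ → Mat2) : Prop where
  system : IsCanonicalSystem S μ (coeffA 𝔞) (coeffB 𝔞)
  gauge : CoeffInArovGauge μ (coeffA 𝔞) (coeffB 𝔞)
  solves : SolvesCanonicalSystem S μ (coeffA 𝔞) (coeffB 𝔞) 𝔄

/-- The distribution function of `μ`, normalized to vanish at `0`. -/
def distrib (μ : MeasureTheory.Measure ℝ) (t : ℝ) : ℝ :=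
  if 0 ≤ t then μ.real (Set.Ico 0 t) else -μ.real (Set.Ico t 0)

/-- On `S` the matrix function `F` is locally absolutely continuous with respect to `μ`, with
Radon–Nikodym derivative `∂_μ F = D`. -/
def HasRNDeriv (S : Set ℝ) (μ : MeasureTheory.Measure ℝ) (F D : ℝ → Mat2) : Prop :=
  LocInt S μ D ∧ ∀ a ∈ S, ∀ b ∈ S, F b - F a = matIntegral μ D a b

/-- `κ(ℓ) = ∫₀^ℓ 2 𝔞(l) e^{-2μ(l)} dμ(l)`. -/
def kappa (μ : MeasureTheory.Measure ℝ) (𝔞 : ℝ → ℂ) (t : ℝ) : ℂ :=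
  ∫ l in (0 : ℝ)..t, 2 * 𝔞 l * (Real.exp (-2 * distrib μ l) : ℂ) ∂μ

end Arov

end

/-!
Along the family, `C = 𝔄(·, s)⁻¹ 𝔄(·, t)` is `j`-inner of determinant one and lower triangular at
`i`. For such a `C` everything is controlled by its mass `m = log C₁₁(i)`. In the upper half plane
the functionals `defect w C`, `|w| = 1`, have nonnegative real part and size `O(m)` at `i`, so
Harnack's inequality bounds `C(z) - 1` by `O(m) / Im z`. The symmetry `C(z̄) = σ C(z)⋆ σ`, with `⋆`
the entrywise conjugate and `σ` the swap of coordinates, carries this to the lower half plane, and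
the maximum principle removes the blow-up at the real axis: `C - 1 = O(m)` uniformly on compact
sets. The same bound holds up to radius `1 / m`, hence `C - 1` agrees with its affine interpolant at
`± i` up to `O(m²)`.

Since masses add along the family, `𝔄(z, ·)` is locally Lipschitz in the parameter
`x = log 𝔄₁₁(i, ·)`. It is therefore differentiable almost everywhere in `x`, and the interpolation
identifies the derivative at every `z` from the derivative at `i`, which gives the canonical system
with respect to Lebesgue measure in `x`. The measure `μ` is the pullback of Lebesgue measure.
Conversely, the system at `z = i` is triangular and is integrated explicitly by the product rule
with the factor `exp (-μ(ℓ))`.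
-/

noncomputable section

open Complex Metric Set Filter Topology MeasureTheory

namespace Arov

/-! ### Growth estimates for holomorphic functions -/

theorem norm_mul_le_of_re_nonneg {f : ℂ → ℂ} {z : ℂ} (hf : DifferentiableOn ℂ f (ball 0 1))
    (hre : ∀ w ∈ ball (0 : ℂ) 1, 0 ≤ (f w).re) (hz : z ∈ ball (0 : ℂ) 1) :
    ‖f z‖ * (1 - ‖z‖) ≤ (1 + ‖z‖) * ‖f 0‖ := by
  have hz1 : ‖z‖ < 1 := mem_ball_zero_iff.1 hz
  have key (M : ℝ) (hM : 0 < M) : ‖f z‖ * (1 - ‖z‖) ≤ (1 + ‖z‖) * ‖f 0‖ + 2 * ‖z‖ * M := by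
    have hmaps : MapsTo (-f) (ball 0 1) {w | w.re ≤ M} := fun w hw => by
      have := hre w hw
      simp only [mem_ofPred_eq, Pi.neg_apply, neg_re]
      linarith
    have h := borelCaratheodory hM hf.neg hmaps one_pos hz
    simp only [Pi.neg_apply, norm_neg] at h
    rw [← add_div, le_div_iff₀ (sub_pos.2 hz1)] at h
    linarith
  refine le_of_forall_pos_le_add fun ε hε => (key (ε / 2) (half_pos hε)).trans ?_
  gcongr
  nlinarith

theorem one_sub_sq_norm_sub_I_div_add_I {z : ℂ} (hz : 0 < z.im) :
    (1 - ‖(z - I) / (z + I)‖ ^ 2) * ‖z + I‖ ^ 2 = 4 * z.im := by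
  have hne : ‖z + I‖ ^ 2 ≠ 0 := by
    refine pow_ne_zero 2 (norm_ne_zero_iff.2 fun h => ?_)
    have := congrArg im h
    simp only [add_im, I_im, zero_im] at this
    linarith
  rw [norm_div, div_pow, sub_mul, div_mul_cancel₀ _ hne, one_mul, ← normSq_eq_norm_sq,
    ← normSq_eq_norm_sq, normSq_apply, normSq_apply]
  simp only [add_re, add_im, sub_re, sub_im, I_re, I_im]
  ring

theorem im_I_mul_one_add_div_one_sub_pos {w : ℂ} (hw : w ∈ ball (0 : ℂ) 1) :
    0 < (I * (1 + w) / (1 - w)).im := by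
  have hw1 : normSq w < 1 := by
    rw [normSq_eq_norm_sq]
    exact pow_lt_one₀ (norm_nonneg w) (mem_ball_zero_iff.1 hw) two_ne_zero
  have hne : 1 - w ≠ 0 := fun h => by
    rw [← sub_eq_zero.1 h, map_one] at hw1
    exact lt_irrefl _ hw1
  have hpos : 0 < normSq (1 - w) := normSq_pos.2 hne
  have him : (I * (1 + w) / (1 - w)).im = (1 - normSq w) / normSq (1 - w) := by
    rw [div_im, ← sub_div, normSq_apply w]
    congr 1
    simp only [mul_re, mul_im, add_re, add_im, sub_re, sub_im, I_re, I_im, one_re, one_im]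
    ring
  rw [him]
  exact div_pos (sub_pos.2 hw1) hpos

theorem norm_mul_im_le_of_re_nonneg {f : ℂ → ℂ} (hf : DifferentiableOn ℂ f {w | 0 < w.im})
    (hre : ∀ w, 0 < w.im → 0 ≤ (f w).re) {z : ℂ} (hz : 0 < z.im) :
    ‖f z‖ * z.im ≤ (‖z‖ + 1) ^ 2 * ‖f I‖ := by
  set φ : ℂ → ℂ := fun w => I * (1 + w) / (1 - w) with hφ
  set ζ := (z - I) / (z + I) with hζ
  have hζz := one_sub_sq_norm_sub_I_div_add_I hz
  have hne : z + I ≠ 0 := fun h => by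
    have := congrArg im h
    simp only [add_im, I_im, zero_im] at this
    linarith
  have hpos : 0 < ‖z + I‖ ^ 2 := pow_pos (norm_pos_iff.2 hne) 2
  have hζ1 : ‖ζ‖ < 1 := by
    have : 0 < 1 - ‖ζ‖ ^ 2 := pos_of_mul_pos_left (by linarith) hpos.le
    nlinarith [norm_nonneg ζ]
  have hφζ : φ ζ = z := by
    have h1 : 1 + ζ = 2 * z / (z + I) := by rw [hζ]; field_simp; ring
    have h2 : 1 - ζ = 2 * I / (z + I) := by rw [hζ]; field_simp; ring
    simp only [hφ, h1, h2]
    field_simp [I_ne_zero]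
  have hd : DifferentiableOn ℂ φ (ball 0 1) := by
    refine (DifferentiableOn.const_mul (by fun_prop) I).div (by fun_prop) fun w hw h => ?_
    rw [← sub_eq_zero.1 h, mem_ball_zero_iff, norm_one] at hw
    exact lt_irrefl _ hw
  have h := norm_mul_le_of_re_nonneg (hf.comp hd fun w => im_I_mul_one_add_div_one_sub_pos)
    (fun w hw => hre _ (im_I_mul_one_add_div_one_sub_pos hw)) (mem_ball_zero_iff.2 hζ1)
  have hφ0 : φ 0 = I := by simp [hφ]
  rw [Function.comp_apply, Function.comp_apply, hφζ, hφ0] at h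
  have hsq : ‖f z‖ * (1 - ‖ζ‖ ^ 2) ≤ 4 * ‖f I‖ := by
    calc ‖f z‖ * (1 - ‖ζ‖ ^ 2) = ‖f z‖ * (1 - ‖ζ‖) * (1 + ‖ζ‖) := by ring
      _ ≤ (1 + ‖ζ‖) * ‖f I‖ * (1 + ‖ζ‖) := by gcongr
      _ ≤ (1 + 1) * ‖f I‖ * (1 + 1) := by gcongr
      _ = 4 * ‖f I‖ := by ring
  have hzI : ‖z + I‖ ≤ ‖z‖ + 1 := by simpa using norm_add_le z I
  calc ‖f z‖ * z.im = ‖f z‖ * (1 - ‖ζ‖ ^ 2) * ‖z + I‖ ^ 2 / 4 := by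
        rw [mul_assoc, hζz]
        ring
    _ ≤ 4 * ‖f I‖ * (‖z‖ + 1) ^ 2 / 4 := by gcongr
    _ = (‖z‖ + 1) ^ 2 * ‖f I‖ := by ring

theorem exists_differentiableOn_exp_eq {U : Set ℂ} (hU : IsOpen U) (hUc : Convex ℝ U)
    (hne : U.Nonempty) {g : ℂ → ℂ} (hg : DifferentiableOn ℂ g U) (hg0 : ∀ z ∈ U, g z ≠ 0) :
    ∃ L : ℂ → ℂ, DifferentiableOn ℂ L U ∧ ∀ z ∈ U, exp (L z) = g z := by
  have := hUc.contractibleSpace hne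
  have hsc : IsSimplyConnected U := (inferInstance : SimplyConnectedSpace U)
  obtain ⟨L, hL, hLg⟩ := exists_continuousOn_eqOn_exp_comp hsc hU hg.continuousOn
    (by rintro ⟨z, hz, h⟩; exact hg0 z hz h)
  refine ⟨L, fun z hz => DifferentiableAt.differentiableWithinAt ?_, hLg⟩
  have hLz : ContinuousAt L z := hL.continuousAt (hU.mem_nhds hz)
  have hexp := (hasStrictDerivAt_exp (L z)).hasStrictFDerivAt_equiv (exp_ne_zero _)
  have hleft : ∀ᶠ w in 𝓝 z, hexp.localInverse _ _ _ (g w) = L w := by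
    filter_upwards [hLz.eventually hexp.eventually_left_inverse, hU.mem_nhds hz] with w hw hwU
    rw [← hLg hwU]
    exact hw
  have hgz : exp (L z) = g z := hLg hz
  refine DifferentiableAt.congr_of_eventuallyEq ?_ (hleft.mono fun w hw => hw.symm)
  refine DifferentiableAt.comp z ?_ (hg.differentiableAt (hU.mem_nhds hz))
  rw [← hgz]
  exact hexp.to_localInverse.differentiableAt

theorem log_norm_mul_im_le {g : ℂ → ℂ} (hg : DifferentiableOn ℂ g {w | 0 < w.im})
    (h1 : ∀ w, 0 < w.im → 1 ≤ ‖g w‖) {z : ℂ} (hz : 0 < z.im) :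
    Real.log ‖g z‖ * z.im ≤ (‖z‖ + 1) ^ 2 * Real.log ‖g I‖ := by
  have hI : 0 < I.im := by simp
  obtain ⟨L, hL, hexp⟩ := exists_differentiableOn_exp_eq (isOpen_lt continuous_const continuous_im)
    (convex_halfSpace_im_gt 0) ⟨I, hI⟩ hg
    fun w hw => norm_pos_iff.1 (one_pos.trans_le (h1 w hw))
  have hre (w : ℂ) (hw : 0 < w.im) : (L w - (L I).im * I).re = Real.log ‖g w‖ := by
    rw [← hexp w hw, norm_exp, Real.log_exp]
    simp
  have hval : L I - (L I).im * I = (Real.log ‖g I‖ : ℂ) := by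
    rw [← hre I hI]
    apply Complex.ext <;> simp
  have h := norm_mul_im_le_of_re_nonneg (hL.sub_const ((L I).im * I))
    (fun w hw => (hre w hw).symm ▸ Real.log_nonneg (h1 w hw)) hz
  rw [hval, norm_real, Real.norm_of_nonneg (Real.log_nonneg (h1 I hI))] at h
  refine le_trans ?_ h
  gcongr
  rw [← hre z hz]
  exact re_le_norm _

/-- A holomorphic weight on the square `|Re w| + |Im w| < R` whose real part is at least
`1 / (2 |Im w|)` on its boundary; it absorbs growth of the form `exp (K / |Im w|)`. -/
def diamondWeight (R : ℝ) (w : ℂ) : ℂ := ((R : ℂ) - w)⁻¹ + ((R : ℂ) + w)⁻¹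

theorem inv_two_mul_le_re_inv {w : ℂ} {s : ℝ} (hw : 0 < w.re) (hs : w.re = s) (him : |w.im| ≤ s) :
    (2 * s)⁻¹ ≤ (w⁻¹).re := by
  have h : w.im * w.im ≤ s * s := by
    rw [← abs_mul_abs_self]
    exact mul_self_le_mul_self (abs_nonneg _) him
  rw [inv_re, normSq_apply, hs, inv_eq_one_div, div_le_div_iff₀ (by linarith) (by nlinarith)]
  nlinarith

theorem re_inv_nonneg {w : ℂ} (hw : 0 ≤ w.re) : 0 ≤ (w⁻¹).re := by
  rw [inv_re]
  exact div_nonneg hw (normSq_nonneg w)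

theorem inv_le_re_diamondWeight {R ε : ℝ} (hε : 0 < ε) {w : ℂ}
    (hw : |w.re| + |w.im| = R - ε) : (2 * (|w.im| + ε))⁻¹ ≤ (diamondWeight R w).re := by
  have hnn (u : ℂ) (hu : |u.re| + |u.im| = R - ε) : 0 ≤ (((R : ℂ) - u)⁻¹).re :=
    re_inv_nonneg (by
      rw [sub_re, ofReal_re]
      linarith [le_abs_self u.re, abs_nonneg u.im])
  have hside (u : ℂ) (h0 : 0 ≤ u.re) (hu : |u.re| + |u.im| = R - ε) :
      (2 * (|u.im| + ε))⁻¹ ≤ (((R : ℂ) - u)⁻¹).re := by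
    have hs : ((R : ℂ) - u).re = |u.im| + ε := by
      rw [sub_re, ofReal_re]
      rw [abs_of_nonneg h0] at hu
      linarith
    refine inv_two_mul_le_re_inv (by rw [hs]; linarith [abs_nonneg u.im]) hs ?_
    rw [sub_im, ofReal_im, zero_sub, abs_neg]
    linarith
  have hneg : |(-w).re| + |(-w).im| = R - ε := by rwa [neg_re, neg_im, abs_neg, abs_neg]
  rw [diamondWeight, add_re, ← sub_neg_eq_add (R : ℂ) w]
  rcases le_total 0 w.re with h | h
  · exact le_add_of_le_of_nonneg (hside w h hw) (hnn _ hneg)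
  · have := hside (-w) (by simpa using h) hneg
    rw [neg_im, abs_neg] at this
    exact le_add_of_nonneg_of_le (hnn _ hw) this

theorem norm_diamondWeight_le {R : ℝ} (hR : 0 < R) {z : ℂ} (hz : ‖z‖ ≤ R / 4) :
    ‖diamondWeight R z‖ ≤ 4 / R := by
  have hinv (w : ℂ) (hw : ‖w‖ ≤ R / 4) : ‖((R : ℂ) - w)⁻¹‖ ≤ 2 / R := by
    have h : R - ‖w‖ ≤ ‖(R : ℂ) - w‖ := by
      simpa only [norm_real, Real.norm_of_nonneg hR.le] using norm_sub_norm_le (R : ℂ) w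
    rw [norm_inv, inv_eq_one_div, div_le_div_iff₀ (by linarith) hR]
    linarith
  rw [diamondWeight, ← sub_neg_eq_add (R : ℂ) z]
  calc _ ≤ 2 / R + 2 / R := norm_add_le_of_le (hinv z hz) (hinv (-z) (by rwa [norm_neg]))
    _ = 4 / R := by ring

theorem diffContOnCl_diamondWeight {R r : ℝ} (hr : r < R) :
    DiffContOnCl ℂ (diamondWeight R) {w | |w.re| + |w.im| < r} := by
  have hcl : closure {w : ℂ | |w.re| + |w.im| < r} ⊆ {w | |w.re| + |w.im| ≤ r} :=
    closure_lt_subset_le (by fun_prop) continuous_const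
  have hne (w : ℂ) (hw : |w.re| + |w.im| ≤ r) : (R : ℂ) - w ≠ 0 := fun h => by
    have hRw : R = w.re := by simpa using congrArg re (sub_eq_zero.1 h)
    linarith [le_abs_self w.re, abs_nonneg w.im]
  refine DifferentiableOn.diffContOnCl (DifferentiableOn.add
    (DifferentiableOn.inv (by fun_prop) fun w hw => hne w (hcl hw))
    (DifferentiableOn.inv (by fun_prop) fun w hw => ?_))
  have hw' : |w.re| + |w.im| ≤ r := hcl hw
  rw [← sub_neg_eq_add]
  exact hne (-w) (by rwa [neg_re, neg_im, abs_neg, abs_neg])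

theorem norm_le_exp_mul_re_diamondWeight {g : ℂ → ℂ} (hg : Differentiable ℂ g) {K R ε U : ℝ}
    (hK : 0 ≤ K) (hε : 0 < ε) (hU : ∀ z : ℂ, ‖z‖ ≤ R → ‖g z‖ ≤ U) (hUε : U ≤ Real.exp (K / ε))
    (hb : ∀ z : ℂ, ‖z‖ ≤ R → z.im ≠ 0 → ‖g z‖ ≤ Real.exp (K / |z.im|)) {z : ℂ}
    (hz : |z.re| + |z.im| < R - ε) : ‖g z‖ ≤ Real.exp (4 * K * (diamondWeight R z).re) := by
  set V : Set ℂ := {w | |w.re| + |w.im| < R - ε}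
  set F : ℂ → ℂ := fun w => g w * exp (-((4 * K : ℝ) * diamondWeight R w))
  have hF (w : ℂ) : ‖F w‖ = ‖g w‖ / Real.exp (4 * K * (diamondWeight R w).re) := by
    rw [norm_mul, norm_exp, neg_re, re_ofReal_mul, Real.exp_neg, div_eq_mul_inv]
  have hFd : DiffContOnCl ℂ F V := hg.diffContOnCl.smul
    (differentiable_exp.comp_diffContOnCl ((diffContOnCl_diamondWeight (by linarith)).const_smul
      ((4 * K : ℝ) : ℂ)).neg)
  have hVb : Bornology.IsBounded V := isBounded_ball.subset (t := ball 0 R) fun w hw => by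
    have hw' : |w.re| + |w.im| < R - ε := hw
    rw [mem_ball_zero_iff]
    linarith [norm_le_abs_re_add_abs_im w]
  have hFb (w : ℂ) (hw : w ∈ frontier V) : ‖F w‖ ≤ 1 := by
    have hwr : |w.re| + |w.im| = R - ε := frontier_lt_subset_eq
      (f := fun w : ℂ => |w.re| + |w.im|) (by fun_prop) continuous_const hw
    have hwR : ‖w‖ ≤ R := by linarith [norm_le_abs_re_add_abs_im w]
    have hweight : 2 * K / (|w.im| + ε) ≤ 4 * K * (diamondWeight R w).re := by
      have := mul_le_mul_of_nonneg_left (inv_le_re_diamondWeight hε hwr)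
        (by positivity : 0 ≤ 4 * K)
      refine le_trans (le_of_eq ?_) this
      field_simp
      ring
    rw [hF, div_le_one (Real.exp_pos _)]
    rcases lt_or_ge |w.im| ε with h | h
    · refine (hU w hwR).trans (hUε.trans (Real.exp_le_exp.2 (le_trans ?_ hweight)))
      rw [div_le_div_iff₀ hε (by positivity)]
      nlinarith
    · have hpos : 0 < |w.im| := hε.trans_le h
      refine (hb w hwR (abs_pos.1 hpos)).trans (Real.exp_le_exp.2 (le_trans ?_ hweight))
      rw [div_le_div_iff₀ hpos (by positivity)]
      nlinarith
  have h := norm_le_of_forall_mem_frontier_norm_le hVb hFd hFb (subset_closure hz)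
  rwa [hF, div_le_one (Real.exp_pos _)] at h

theorem norm_le_exp_of_norm_le_exp_div_im {g : ℂ → ℂ} (hg : Differentiable ℂ g) {K R : ℝ}
    (hK : 0 ≤ K) (hR : 0 < R)
    (hb : ∀ z : ℂ, ‖z‖ ≤ R → z.im ≠ 0 → ‖g z‖ ≤ Real.exp (K / |z.im|)) {z : ℂ}
    (hz : ‖z‖ ≤ R / 4) : ‖g z‖ ≤ Real.exp (16 * K / R) := by
  obtain ⟨U, hU⟩ := (isCompact_closedBall (0 : ℂ) R).exists_bound_of_continuousOn
    hg.continuous.continuousOn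
  have hlim : Tendsto (fun L => Real.exp (16 * L / R)) (𝓝[>] K) (𝓝 (Real.exp (16 * K / R))) :=
    Continuous.continuousWithinAt (by fun_prop)
  refine ge_of_tendsto hlim (eventually_nhdsWithin_of_forall fun L (hL : K < L) => ?_)
  have hL0 : 0 < L := hK.trans_lt hL
  obtain ⟨ε, hε, hεR, hεU⟩ : ∃ ε, 0 < ε ∧ ε ≤ R / 4 ∧ U ≤ L / ε := by
    refine ⟨min (R / 4) (L / max U 1), lt_min (by linarith) (by positivity), min_le_left _ _, ?_⟩
    rw [le_div_iff₀ (lt_min (by linarith) (by positivity))]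
    calc U * min (R / 4) (L / max U 1) ≤ max U 1 * (L / max U 1) := by
          gcongr
          exacts [le_max_left _ _, min_le_right _ _]
      _ = L := mul_div_cancel₀ _ (by positivity)
  have hzε : |z.re| + |z.im| < R - ε := by
    linarith [abs_re_le_norm z, abs_im_le_norm z]
  have hbL (w : ℂ) (hw : ‖w‖ ≤ R) (him : w.im ≠ 0) : ‖g w‖ ≤ Real.exp (L / |w.im|) :=
    (hb w hw him).trans (Real.exp_le_exp.2 (by gcongr))
  have hUε : U ≤ Real.exp (L / ε) := by linarith [Real.add_one_le_exp (L / ε)]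
  refine (norm_le_exp_mul_re_diamondWeight hg hL0.le hε (fun w hw => hU w (by simpa using hw)) hUε
    hbL hzε).trans (Real.exp_le_exp.2 ?_)
  calc 4 * L * (diamondWeight R z).re ≤ 4 * L * (4 / R) := by
        gcongr
        exact (re_le_norm _).trans (norm_diamondWeight_le hR hz)
    _ = 16 * L / R := by ring

theorem norm_sq_sub_sq_of_norm_eq {w : ℂ} {ρ : ℝ} (hw : ‖w‖ = ρ) :
    ‖w ^ 2 - (ρ : ℂ) ^ 2‖ = 2 * ρ * |w.im| := by
  have h : w ^ 2 - (ρ : ℂ) ^ 2 = w * ((2 * w.im : ℝ) * I) := by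
    rw [← sub_conj, mul_sub, mul_conj, normSq_eq_norm_sq, hw]
    push_cast
    ring
  rw [h, norm_mul, norm_mul, norm_I, hw, norm_real, Real.norm_eq_abs, abs_mul, abs_two]
  ring

theorem norm_le_of_forall_norm_mul_abs_im_le {h : ℂ → ℂ} (hh : Differentiable ℂ h) {ρ M : ℝ}
    (hρ : 0 < ρ) (hM : ∀ w : ℂ, ‖w‖ = ρ → ‖h w‖ * |w.im| ≤ M) {z : ℂ} (hz : ‖z‖ ≤ ρ / 2) :
    ‖h z‖ ≤ 8 * M / (3 * ρ) := by
  have hd : Differentiable ℂ fun w => h w * (w ^ 2 - (ρ : ℂ) ^ 2) := by fun_prop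
  have hmax : ‖h z * (z ^ 2 - (ρ : ℂ) ^ 2)‖ ≤ 2 * ρ * M := by
    refine norm_le_of_forall_mem_frontier_norm_le (U := ball 0 ρ) isBounded_ball hd.diffContOnCl
      (fun w hw => ?_) (subset_closure (mem_ball_zero_iff.2 (by linarith)))
    rw [frontier_ball _ hρ.ne', mem_sphere_zero_iff_norm] at hw
    rw [norm_mul, norm_sq_sub_sq_of_norm_eq hw, mul_left_comm]
    exact mul_le_mul_of_nonneg_left (hM w hw) (by linarith)
  have hlow : 3 / 4 * ρ ^ 2 ≤ ‖z ^ 2 - (ρ : ℂ) ^ 2‖ := by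
    have := norm_sub_norm_le ((ρ : ℂ) ^ 2) (z ^ 2)
    rw [norm_sub_rev, norm_pow, norm_pow, norm_real, Real.norm_of_nonneg hρ.le] at this
    nlinarith [norm_nonneg z]
  rw [norm_mul] at hmax
  have hmul : ‖h z‖ * (3 / 4 * ρ ^ 2) ≤ 2 * ρ * M :=
    (mul_le_mul_of_nonneg_left hlow (norm_nonneg _)).trans hmax
  rw [le_div_iff₀ (by positivity)]
  refine le_of_mul_le_mul_right ?_ hρ
  linarith

theorem norm_mul_le_of_apply_I_eq_zero {h : ℂ → ℂ} (hh : Differentiable ℂ h) (h1 : h I = 0)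
    (h2 : h (-I) = 0) {ρ M : ℝ} (hρ : 1 < ρ) (hM : ∀ w : ℂ, ‖w‖ = ρ → ‖h w‖ ≤ M) {z : ℂ}
    (hz : ‖z‖ ≤ ρ) : ‖h z‖ * (ρ ^ 2 - 1) ≤ M * ‖z ^ 2 + 1‖ := by
  set q : ℂ → ℂ := dslope (dslope h I) (-I)
  have hq : Differentiable ℂ q := by
    rw [← differentiableOn_univ, differentiableOn_dslope univ_mem, differentiableOn_dslope univ_mem]
    exact hh.differentiableOn
  have hfac (w : ℂ) : h w = (w ^ 2 + 1) * q w := by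
    have hI : dslope h I (-I) = 0 := by
      have := sub_smul_dslope h I (-I)
      rw [h1, h2, sub_zero, smul_eq_mul] at this
      exact (mul_eq_zero.1 this).resolve_left fun h => by
        norm_num [Complex.ext_iff] at h
    have e1 := sub_smul_dslope h I w
    have e2 := sub_smul_dslope (dslope h I) (-I) w
    rw [h1, sub_zero, smul_eq_mul] at e1
    rw [hI, sub_zero, smul_eq_mul] at e2
    rw [← e1, ← e2]
    linear_combination (-q w) * I_sq
  have hpos : 0 < ρ ^ 2 - 1 := by nlinarith
  have hqz : ‖q z‖ ≤ M / (ρ ^ 2 - 1) := by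
    refine norm_le_of_forall_mem_frontier_norm_le (U := ball 0 ρ) isBounded_ball hq.diffContOnCl
      (fun w hw => ?_) (by rwa [closure_ball _ (by linarith), mem_closedBall_zero_iff])
    rw [frontier_ball _ (by linarith), mem_sphere_zero_iff_norm] at hw
    have hlow : ρ ^ 2 - 1 ≤ ‖w ^ 2 + 1‖ := by
      have := norm_sub_norm_le (w ^ 2) (-1)
      rwa [norm_pow, hw, norm_neg, norm_one, sub_neg_eq_add] at this
    rw [le_div_iff₀ hpos]
    refine le_trans ?_ (hM w hw)
    rw [hfac, norm_mul, mul_comm]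
    gcongr
  rw [hfac, norm_mul, mul_assoc, mul_comm]
  exact mul_le_mul_of_nonneg_right ((le_div_iff₀ hpos).1 hqz) (norm_nonneg _)

/-- The affine function with the same values as `h` at `i` and `-i`. -/
def interpolantAtI (h : ℂ → ℂ) (z : ℂ) : ℂ := (1 - I * z) / 2 * h I + (1 + I * z) / 2 * h (-I)

theorem norm_interpolantAtI_le {h : ℂ → ℂ} {m : ℝ} (h1 : ‖h I‖ ≤ m) (h2 : ‖h (-I)‖ ≤ m) (z : ℂ) :
    ‖interpolantAtI h z‖ ≤ (1 + ‖z‖) * m := by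
  have hm : ‖I * z‖ = ‖z‖ := by rw [norm_mul, norm_I, one_mul]
  have e1 : ‖(1 - I * z) / 2‖ ≤ (1 + ‖z‖) / 2 := by
    rw [norm_div, RCLike.norm_ofNat, ← hm]
    gcongr
    simpa using norm_sub_le (1 : ℂ) (I * z)
  have e2 : ‖(1 + I * z) / 2‖ ≤ (1 + ‖z‖) / 2 := by
    rw [norm_div, RCLike.norm_ofNat, ← hm]
    gcongr
    simpa using norm_add_le (1 : ℂ) (I * z)
  calc ‖interpolantAtI h z‖ ≤ (1 + ‖z‖) / 2 * m + (1 + ‖z‖) / 2 * m :=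
        norm_add_le_of_le (norm_mul_le_of_le e1 h1) (norm_mul_le_of_le e2 h2)
    _ = (1 + ‖z‖) * m := by ring

theorem norm_sub_interpolantAtI_le {h : ℂ → ℂ} (hh : Differentiable ℂ h) {ρ M m : ℝ} (hρ : 2 ≤ ρ)
    (hM : ∀ w : ℂ, ‖w‖ = ρ → ‖h w‖ ≤ M) (h1 : ‖h I‖ ≤ m) (h2 : ‖h (-I)‖ ≤ m) {z : ℂ}
    (hz : ‖z‖ ≤ ρ) :
    ‖h z - interpolantAtI h z‖ * (ρ ^ 2 - 1) ≤ (M + (1 + ρ) * m) * ‖z ^ 2 + 1‖ := by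
  refine norm_mul_le_of_apply_I_eq_zero (h := fun w => h w - interpolantAtI h w)
    (hh.sub ?_) ?_ ?_ (by linarith) (fun w hw => ?_) hz
  · unfold interpolantAtI
    fun_prop
  · simp only [interpolantAtI, I_mul_I]
    ring
  · simp only [interpolantAtI, mul_neg, I_mul_I]
    ring
  · rw [← hw]
    exact norm_sub_le_of_le (hM w hw) (norm_interpolantAtI_le h1 h2 w)

/-! ### Inner matrix functions normalized at `i` -/

theorem eq_of_eq_on_real {f g : ℂ → ℂ} (hf : Differentiable ℂ f) (hg : Differentiable ℂ g)
    (h : ∀ x : ℝ, f x = g x) : f = g := by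
  refine AnalyticOnNhd.eq_of_frequently_eq (z₀ := 0) (fun z _ => hf.analyticAt z)
    (fun z _ => hg.analyticAt z) ?_
  have hlim : Tendsto (fun x : ℝ => (x : ℂ)) (𝓝[≠] 0) (𝓝[≠] 0) := by
    refine tendsto_nhdsWithin_iff.2 ⟨?_, ?_⟩
    · simpa using (continuous_ofReal.tendsto 0).mono_left nhdsWithin_le_nhds
    · filter_upwards [self_mem_nhdsWithin] with x hx
      simpa using hx
  exact hlim.frequently (Eventually.of_forall h).frequently

section Contractive

variable {X : Mat2}

theorem normSq_add_normSq_le (h : (jMat - X * jMat * Xᴴ).PosSemidef) (v w : ℂ) :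
    normSq v + normSq (v * X 0 1 + w * X 1 1) ≤ normSq w + normSq (v * X 0 0 + w * X 1 0) := by
  have hq := (Complex.le_def.1 (h.dotProduct_mulVec_nonneg ![star v, star w])).1
  simp only [zero_re, dotProduct, RCLike.star_def, Pi.star_apply, Matrix.mulVec, jMat,
    Matrix.sub_apply, Matrix.of_apply, Matrix.cons_val', Matrix.cons_val_fin_one, Matrix.mul_apply,
    Fin.sum_univ_two, Fin.isValue, Matrix.cons_val_zero, Matrix.cons_val_one,
    Matrix.conjTranspose_apply, mul_neg, mul_one, mul_zero, add_zero, neg_mul, zero_add,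
    RingHomCompTriple.comp_apply, RingHom.id_apply, zero_sub, neg_add_rev, neg_neg, add_re, mul_re,
    sub_re, neg_re, one_re, conj_re, conj_im, sub_neg_eq_add, sub_im, neg_im, one_im, neg_zero,
    add_im, mul_im] at hq
  simp only [normSq_apply, add_re, add_im, mul_re, mul_im]
  linarith

theorem one_add_normSq_le (h : (jMat - X * jMat * Xᴴ).PosSemidef) :
    1 + normSq (X 0 1) ≤ normSq (X 0 0) := by
  simpa using normSq_add_normSq_le h 1 0

theorem one_le_norm_of_posSemidef (h : (jMat - X * jMat * Xᴴ).PosSemidef) : 1 ≤ ‖X 0 0‖ := by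
  have h1 := one_add_normSq_le h
  rw [normSq_eq_norm_sq (X 0 0)] at h1
  nlinarith [normSq_nonneg (X 0 1), norm_nonneg (X 0 0)]

theorem norm_le_of_posSemidef (hdet : X.det = 1) (h : (jMat - X * jMat * Xᴴ).PosSemidef)
    (i k : Fin 2) : ‖X i k‖ ≤ ‖X 0 0‖ := by
  have h1 := one_le_norm_of_posSemidef h
  have h0 : X 0 0 ≠ 0 := norm_pos_iff.1 (one_pos.trans_le h1)
  rw [Matrix.det_fin_two] at hdet
  have hb := one_add_normSq_le h
  have hc : 1 + normSq (X 1 0) ≤ normSq (X 0 0) := by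
    have := normSq_add_normSq_le h (-(X 1 0 / X 0 0)) 1
    rw [show -(X 1 0 / X 0 0) * X 0 1 + 1 * X 1 1 = (X 0 0)⁻¹ by
        field_simp
        linear_combination hdet,
      show -(X 1 0 / X 0 0) * X 0 0 + 1 * X 1 0 = 0 by field_simp; ring, map_zero, map_one,
      normSq_neg, normSq_div, normSq_inv, inv_eq_one_div, ← add_div, add_zero,
      div_le_one (normSq_pos.2 h0)] at this
    linarith
  have hd : normSq (X 1 1) ≤ 1 + normSq (X 1 0) := by
    simpa using normSq_add_normSq_le h 0 1
  simp only [normSq_eq_norm_sq] at hb hc hd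
  refine (sq_le_sq₀ (norm_nonneg _) (norm_nonneg _)).1 ?_
  fin_cases i <;> fin_cases k
  exacts [le_rfl, by linarith!, by linarith!, by linarith!]

theorem norm_two_sub_mul_add_mul_le (hdet : X.det = 1) (h : (jMat - X * jMat * Xᴴ).PosSemidef)
    {w : ℂ} (hw : ‖w‖ = 1) : ‖2 - w * X 1 0 + star w * X 0 1‖ ≤ 2 * ‖X 0 0‖ := by
  have h0 : X 0 0 ≠ 0 := norm_pos_iff.1 (one_pos.trans_le (one_le_norm_of_posSemidef h))
  rw [Matrix.det_fin_two] at hdet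
  have hww : w * star w = 1 := by
    rw [star_def, mul_conj, normSq_eq_norm_sq, hw, one_pow, ofReal_one]
  have hq := normSq_add_normSq_le h ((1 - w * X 1 0) / X 0 0) w
  rw [show (1 - w * X 1 0) / X 0 0 * X 0 1 + w * X 1 1 = w * (1 + star w * X 0 1) / X 0 0 by
      field_simp
      linear_combination w * hdet - X 0 1 * hww,
    show (1 - w * X 1 0) / X 0 0 * X 0 0 + w * X 1 0 = 1 by field_simp; ring,
    normSq_div, normSq_div, ← add_div, div_le_iff₀ (normSq_pos.2 h0), map_mul, map_one] at hq
  simp only [normSq_eq_norm_sq, hw] at hq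
  calc ‖2 - w * X 1 0 + star w * X 0 1‖ = ‖(1 - w * X 1 0) + (1 + star w * X 0 1)‖ := by
        congr 1
        ring
    _ ≤ ‖1 - w * X 1 0‖ + ‖1 + star w * X 0 1‖ := norm_add_le _ _
    _ ≤ 2 * ‖X 0 0‖ := by
        refine abs_le_of_sq_le_sq' ?_ (by positivity) |>.2
        nlinarith [sq_nonneg (‖1 - w * X 1 0‖ - ‖1 + star w * X 0 1‖)]

/-- The Herglotz-type functional of a contractive matrix in the direction `w` of the unit circle:
it has nonnegative real part, and the values for `w = ±1, ±i` determine the matrix. -/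
def defect (w : ℂ) (X : Mat2) : ℂ := 1 - (2 - w * X 1 0 + star w * X 0 1) / (2 * X 0 0)

theorem re_defect_nonneg (hdet : X.det = 1) (h : (jMat - X * jMat * Xᴴ).PosSemidef) {w : ℂ}
    (hw : ‖w‖ = 1) : 0 ≤ (defect w X).re := by
  have h0 := one_pos.trans_le (one_le_norm_of_posSemidef h)
  have hle : ‖(2 - w * X 1 0 + star w * X 0 1) / (2 * X 0 0)‖ ≤ 1 := by
    rw [norm_div, norm_mul, RCLike.norm_ofNat, div_le_one (by positivity)]
    exact norm_two_sub_mul_add_mul_le hdet h hw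
  rw [defect, sub_re, one_re]
  linarith [re_le_norm ((2 - w * X 1 0 + star w * X 0 1) / (2 * X 0 0))]

theorem norm_one_sub_inv_le_of_norm_defect_le {ε : ℝ} (h0 : X 0 0 ≠ 0)
    (h : ∀ w : ℂ, ‖w‖ = 1 → ‖defect w X‖ ≤ ε) : ‖1 - (X 0 0)⁻¹‖ ≤ ε := by
  have e : 1 - (X 0 0)⁻¹ = (defect 1 X + defect (-1) X) / 2 := by
    simp only [defect, star_one, star_neg]
    field_simp
    ring
  rw [e, norm_div, RCLike.norm_ofNat]
  linarith [norm_add_le_of_le (h 1 (by simp)) (h (-1) (by simp))]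

theorem norm_off_diag_le_of_norm_defect_le {ε : ℝ} (h0 : X 0 0 ≠ 0)
    (h : ∀ w : ℂ, ‖w‖ = 1 → ‖defect w X‖ ≤ ε) :
    ‖X 0 1‖ ≤ 2 * ‖X 0 0‖ * ε ∧ ‖X 1 0‖ ≤ 2 * ‖X 0 0‖ * ε := by
  have hcomb (v : ℂ) (hv : ‖v‖ = 1) : ‖v * X 1 0 - star v * X 0 1‖ ≤ 2 * ‖X 0 0‖ * ε := by
    have e : v * X 1 0 - star v * X 0 1 = X 0 0 * (defect v X - defect (-v) X) := by
      simp only [defect, star_neg]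
      field_simp
      ring
    calc _ ≤ ‖X 0 0‖ * (ε + ε) := by
          rw [e, norm_mul]
          gcongr
          exact norm_sub_le_of_le (h v hv) (h (-v) (by rwa [norm_neg]))
      _ = 2 * ‖X 0 0‖ * ε := by ring
  have hdiff := hcomb 1 (by simp)
  have hsum := hcomb I norm_I
  rw [star_one, one_mul, one_mul] at hdiff
  rw [star_def, conj_I, neg_mul, sub_neg_eq_add, ← mul_add, norm_mul, norm_I, one_mul] at hsum
  have h01 := norm_sub_le_of_le hsum hdiff
  have h10 := norm_add_le_of_le hsum hdiff
  rw [add_sub_sub_cancel, ← two_mul, norm_mul, RCLike.norm_ofNat] at h01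
  rw [add_add_sub_cancel, ← two_mul, norm_mul, RCLike.norm_ofNat] at h10
  constructor <;> linarith

theorem norm_sub_one_apply_le_of_norm_defect_le {ε : ℝ} (hdet : X.det = 1) (h1 : 1 ≤ ‖X 0 0‖)
    (hle : ‖X 0 1‖ ≤ ‖X 0 0‖) (hε : ε ≤ 1 / 2) (h : ∀ w : ℂ, ‖w‖ = 1 → ‖defect w X‖ ≤ ε)
    (i k : Fin 2) : ‖(X - 1) i k‖ ≤ 5 * ε := by
  have h0 : X 0 0 ≠ 0 := norm_pos_iff.1 (one_pos.trans_le h1)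
  have hinv := norm_one_sub_inv_le_of_norm_defect_le h0 h
  have hε0 : 0 ≤ ε := (norm_nonneg _).trans hinv
  have ha : ‖X 0 0‖ ≤ 2 := by
    have : 1 / 2 ≤ ‖X 0 0‖⁻¹ := by
      have := norm_sub_norm_le 1 (1 - (X 0 0)⁻¹)
      rw [sub_sub_cancel, norm_one, norm_inv] at this
      linarith
    simpa using inv_anti₀ (by norm_num) this
  obtain ⟨hb, hc⟩ := norm_off_diag_le_of_norm_defect_le h0 h
  have h4 : 2 * ‖X 0 0‖ * ε ≤ 4 * ε := by nlinarith
  fin_cases i <;> fin_cases k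
  · calc ‖X 0 0 - 1‖ = ‖X 0 0‖ * ‖1 - (X 0 0)⁻¹‖ := by
          rw [← norm_mul, mul_sub, mul_one, mul_inv_cancel₀ h0]
      _ ≤ 2 * ε := by gcongr
      _ ≤ 5 * ε := by linarith
  · simpa using hb.trans (by linarith)
  · simpa using hc.trans (by linarith)
  · have e : X 1 1 - 1 = X 0 1 / X 0 0 * X 1 0 - (1 - (X 0 0)⁻¹) := by
      rw [Matrix.det_fin_two] at hdet
      field_simp
      linear_combination hdet
    have hba : ‖X 0 1 / X 0 0‖ ≤ 1 := by
      rw [norm_div]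
      exact div_le_one_of_le₀ hle (norm_nonneg _)
    calc ‖X 1 1 - 1‖ ≤ 1 * (4 * ε) + ε :=
          e ▸ norm_sub_le_of_le (norm_mul_le_of_le hba (hc.trans h4)) hinv
      _ = 5 * ε := by ring

end Contractive

theorem jMat_mul_jMat : jMat * jMat = 1 := by
  simp [jMat, Matrix.one_fin_two]

theorem differentiable_star_comp_star {f : ℂ → ℂ} (hf : Differentiable ℂ f) :
    Differentiable ℂ fun z => star (f (star z)) := fun z => by
  simpa [Function.comp_def] using (hf (star z)).conj_conj

/-- An entire `j`-inner function of determinant one whose value at `i` is lower triangular with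
positive upper diagonal entry. -/
structure IsArovInner (C : ℂ → Mat2) : Prop where
  inner : IsJInner jMat C
  det : ∀ z, (C z).det = 1
  zero : C I 0 1 = 0
  pos : 0 < C I 0 0

/-- The logarithm of the upper diagonal entry at `i`, which controls the distance of a normalized
inner function to the identity. -/
def mass (C : ℂ → Mat2) : ℝ := Real.log ‖C I 0 0‖

namespace IsArovInner

variable {C : ℂ → Mat2}

theorem one_le_norm (hC : IsArovInner C) {z : ℂ} (hz : 0 < z.im) : 1 ≤ ‖C z 0 0‖ :=
  one_le_norm_of_posSemidef (hC.inner.contractive z hz)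

theorem norm_le (hC : IsArovInner C) {z : ℂ} (hz : 0 < z.im) (i k : Fin 2) :
    ‖C z i k‖ ≤ ‖C z 0 0‖ :=
  norm_le_of_posSemidef (hC.det z) (hC.inner.contractive z hz) i k

theorem mass_nonneg (hC : IsArovInner C) : 0 ≤ mass C :=
  Real.log_nonneg (hC.one_le_norm (by simp))

theorem apply_I_zero_zero_eq_norm (hC : IsArovInner C) : C I 0 0 = (‖C I 0 0‖ : ℂ) :=
  (norm_of_nonneg' hC.pos.le).symm

theorem norm_apply_I_one_zero_le (hC : IsArovInner C) :
    ‖C I 1 0‖ ≤ 2 * (‖C I 0 0‖ - 1) := by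
  obtain ⟨w, hw, hwc⟩ : ∃ w : ℂ, ‖w‖ = 1 ∧ w * C I 1 0 = -(‖C I 1 0‖ : ℂ) := by
    obtain ⟨w, hw, hwc⟩ := RCLike.exists_norm_eq_mul_self (C I 1 0)
    exact ⟨-w, by rwa [norm_neg], by rw [neg_mul, ← hwc]; rfl⟩
  have h := norm_two_sub_mul_add_mul_le (hC.det I) (hC.inner.contractive I (by simp)) hw
  rw [hC.zero, hwc, mul_zero, add_zero, sub_neg_eq_add, ← ofReal_ofNat, ← ofReal_add, norm_real,
    Real.norm_of_nonneg (by positivity)] at h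
  linarith

theorem norm_defect_I_le (hC : IsArovInner C) {w : ℂ} (hw : ‖w‖ = 1) :
    ‖defect w (C I)‖ ≤ 2 * mass C := by
  have h1 : 1 ≤ ‖C I 0 0‖ := hC.one_le_norm (by simp)
  have h0 : 0 < ‖C I 0 0‖ := one_pos.trans_le h1
  have hnum : ‖2 * (C I 0 0 - 1) + w * C I 1 0‖ ≤ 4 * (‖C I 0 0‖ - 1) := by
    have : ‖C I 0 0 - 1‖ = ‖C I 0 0‖ - 1 := by
      rw [hC.apply_I_zero_zero_eq_norm, ← ofReal_one, ← ofReal_sub, norm_real,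
        Real.norm_of_nonneg (sub_nonneg.2 h1), ← hC.apply_I_zero_zero_eq_norm]
    refine (norm_add_le _ _).trans ?_
    rw [norm_mul, norm_mul, hw, this, RCLike.norm_ofNat]
    linarith [hC.norm_apply_I_one_zero_le]
  have e : defect w (C I) = (2 * (C I 0 0 - 1) + w * C I 1 0) / (2 * C I 0 0) := by
    have : C I 0 0 ≠ 0 := norm_pos_iff.1 h0
    rw [defect, hC.zero]
    field_simp
    ring
  calc ‖defect w (C I)‖ ≤ 4 * (‖C I 0 0‖ - 1) / (2 * ‖C I 0 0‖) := by
        rw [e, norm_div, norm_mul 2, RCLike.norm_ofNat]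
        gcongr
    _ = 2 * (1 - ‖C I 0 0‖⁻¹) := by field_simp; ring
    _ ≤ 2 * mass C := by
        gcongr
        exact Real.one_sub_inv_le_log_of_pos h0

theorem norm_defect_mul_im_le (hC : IsArovInner C) {w : ℂ} (hw : ‖w‖ = 1) {z : ℂ}
    (hz : 0 < z.im) : ‖defect w (C z)‖ * z.im ≤ 2 * (‖z‖ + 1) ^ 2 * mass C := by
  have hd : DifferentiableOn ℂ (fun v => defect w (C v)) {v | 0 < v.im} := by
    have hent (i k : Fin 2) : DifferentiableOn ℂ (fun v => C v i k) {v | 0 < v.im} :=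
      (hC.inner.entire i k).differentiableOn
    unfold defect
    refine DifferentiableOn.const_sub (DifferentiableOn.div ?_ ((hent 0 0).const_mul 2)
      fun v hv => mul_ne_zero two_ne_zero (norm_pos_iff.1 (one_pos.trans_le (hC.one_le_norm hv)))) 1
    exact (((hent 1 0).const_mul w).const_sub 2).add ((hent 0 1).const_mul (star w))
  calc ‖defect w (C z)‖ * z.im ≤ (‖z‖ + 1) ^ 2 * ‖defect w (C I)‖ :=
        norm_mul_im_le_of_re_nonneg hd
          (fun v hv => re_defect_nonneg (hC.det v) (hC.inner.contractive v hv) hw) hz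
    _ ≤ (‖z‖ + 1) ^ 2 * (2 * mass C) := by
        gcongr
        exact hC.norm_defect_I_le hw
    _ = 2 * (‖z‖ + 1) ^ 2 * mass C := by ring

theorem conjTranspose_apply_ofReal (hC : IsArovInner C) (x : ℝ) :
    (C x)ᴴ = !![C x 1 1, C x 0 1; C x 1 0, C x 0 0] := by
  have hu : C x * jMat * (C x)ᴴ = jMat := (sub_eq_zero.1 (hC.inner.unitary x)).symm
  have hadj : (C x).adjugate * C x = 1 := by rw [Matrix.adjugate_mul, hC.det, one_smul]
  calc (C x)ᴴ = jMat * ((C x).adjugate * C x) * jMat * (C x)ᴴ := by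
        rw [hadj, mul_one, jMat_mul_jMat, one_mul]
    _ = jMat * (C x).adjugate * (C x * jMat * (C x)ᴴ) := by simp only [mul_assoc]
    _ = _ := by
        rw [hu, Matrix.adjugate_fin_two]
        ext i k
        fin_cases i <;> fin_cases k <;> simp [jMat, Matrix.mul_apply, Fin.sum_univ_two]

theorem apply_star (hC : IsArovInner C) (z : ℂ) (i k : Fin 2) :
    C (star z) i k = star (C z i.rev k.rev) := by
  have h : (fun v => star (C (star v) i k)) = fun v => C v i.rev k.rev := by
    refine eq_of_eq_on_real (differentiable_star_comp_star (hC.inner.entire i k))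
      (hC.inner.entire i.rev k.rev) fun x => ?_
    have hx := congrFun₂ (hC.conjTranspose_apply_ofReal x) k i
    rw [Matrix.conjTranspose_apply] at hx
    rw [star_def, conj_ofReal, ← star_def, hx]
    fin_cases i <;> fin_cases k <;> rfl
  rw [← congrFun h z, star_star]

theorem sub_one_apply_star (hC : IsArovInner C) (z : ℂ) (i k : Fin 2) :
    (C (star z) - 1) i k = star ((C z - 1) i.rev k.rev) := by
  rw [Matrix.sub_apply, Matrix.sub_apply, hC.apply_star, star_sub]
  fin_cases i <;> fin_cases k <;> simp

theorem norm_sub_one_mul_abs_im_le (hC : IsArovInner C) {z : ℂ}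
    (hz : 4 * (‖z‖ + 1) ^ 2 * mass C ≤ |z.im|) (i k : Fin 2) :
    ‖(C z - 1) i k‖ * |z.im| ≤ 10 * (‖z‖ + 1) ^ 2 * mass C := by
  have upper (v : ℂ) (hv : 0 < v.im) (hle : 4 * (‖v‖ + 1) ^ 2 * mass C ≤ v.im) (i k : Fin 2) :
      ‖(C v - 1) i k‖ * v.im ≤ 10 * (‖v‖ + 1) ^ 2 * mass C := by
    have h := norm_sub_one_apply_le_of_norm_defect_le (ε := 2 * (‖v‖ + 1) ^ 2 * mass C / v.im)
      (hC.det v) (hC.one_le_norm hv) (hC.norm_le hv 0 1)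
      (by rw [div_le_div_iff₀ hv two_pos]; linarith)
      (fun w hw => (le_div_iff₀ hv).2 (hC.norm_defect_mul_im_le hw hv)) i k
    rw [← mul_div_assoc, le_div_iff₀ hv] at h
    linarith
  rcases lt_trichotomy z.im 0 with h | h | h
  · have hstar := upper (star z) (by simpa using h)
      (by simpa [abs_of_neg h] using hz) i.rev k.rev
    rw [hC.sub_one_apply_star, norm_star, norm_star, Fin.rev_rev, Fin.rev_rev] at hstar
    rw [abs_of_neg h]
    exact hstar
  · rw [h, abs_zero, mul_zero]
    have := hC.mass_nonneg
    positivity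
  · rw [abs_of_pos h] at hz ⊢
    exact upper z h hz i k

theorem norm_le_exp_div_im (hC : IsArovInner C) {z : ℂ} (him : z.im ≠ 0) (i k : Fin 2) :
    ‖C z i k‖ ≤ Real.exp ((‖z‖ + 1) ^ 2 * mass C / |z.im|) := by
  have upper (v : ℂ) (hv : 0 < v.im) (i k : Fin 2) :
      ‖C v i k‖ ≤ Real.exp ((‖v‖ + 1) ^ 2 * mass C / v.im) := by
    refine (hC.norm_le hv i k).trans ?_
    have h := log_norm_mul_im_le (hC.inner.entire 0 0).differentiableOn
      (fun _ => hC.one_le_norm) hv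
    rw [← le_div_iff₀ hv] at h
    exact (Real.log_le_iff_le_exp (one_pos.trans_le (hC.one_le_norm hv))).1 h
  rcases lt_or_gt_of_ne him with h | h
  · have hstar := upper (star z) (by simpa using h) i.rev k.rev
    rw [hC.apply_star, norm_star, norm_star, Fin.rev_rev, Fin.rev_rev] at hstar
    rw [abs_of_neg h]
    exact hstar
  · rw [abs_of_pos h]
    exact upper z h i k

theorem norm_le_exp (hC : IsArovInner C) {ρ : ℝ} (hρ : 1 ≤ ρ) {z : ℂ} (hz : ‖z‖ ≤ 2 * ρ)
    (i k : Fin 2) : ‖C z i k‖ ≤ Real.exp (162 * ρ * mass C) := by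
  have hm0 := hC.mass_nonneg
  refine (norm_le_exp_of_norm_le_exp_div_im (hC.inner.entire i k)
    (K := (8 * ρ + 1) ^ 2 * mass C) (R := 8 * ρ) (by positivity) (by linarith)
    (fun w hw him => (hC.norm_le_exp_div_im him i k).trans
      (Real.exp_le_exp.2 (by gcongr))) (z := z) (by linarith)).trans (Real.exp_le_exp.2 ?_)
  have hsq : 2 * (8 * ρ + 1) ^ 2 ≤ 162 * ρ * ρ := by nlinarith
  rw [div_le_iff₀ (by linarith)]
  linarith [mul_le_mul_of_nonneg_right hsq hm0]

theorem norm_le_three (hC : IsArovInner C) {ρ : ℝ} (hρ : 1 ≤ ρ) (hm : ρ * mass C ≤ 1 / 200)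
    {z : ℂ} (hz : ‖z‖ ≤ 2 * ρ) (i k : Fin 2) : ‖C z i k‖ ≤ 3 := by
  have hexp : Real.exp (162 * ρ * mass C) ≤ Real.exp 1 := Real.exp_le_exp.2 (by linarith)
  linarith [hC.norm_le_exp hρ hz i k, Real.exp_one_lt_d9]

theorem norm_sub_one_le (hC : IsArovInner C) {ρ : ℝ} (hρ : 1 ≤ ρ) (hm : ρ * mass C ≤ 1 / 200)
    {z : ℂ} (hz : ‖z‖ ≤ ρ) (i k : Fin 2) : ‖(C z - 1) i k‖ ≤ 192 * (ρ * mass C) := by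
  have hm0 := hC.mass_nonneg
  have hcircle (w : ℂ) (hw : ‖w‖ = 2 * ρ) : ‖(C w - 1) i k‖ * |w.im| ≤ 144 * ρ ^ 2 * mass C := by
    have hsq : (‖w‖ + 1) ^ 2 * mass C ≤ 9 * ρ ^ 2 * mass C := by
      rw [hw]
      gcongr
      nlinarith
    have hpos : 0 ≤ ρ ^ 2 * mass C := by positivity
    rcases le_total (4 * (‖w‖ + 1) ^ 2 * mass C) |w.im| with h | h
    · linarith [hC.norm_sub_one_mul_abs_im_le h i k]
    · have h4 : ‖(C w - 1) i k‖ ≤ 3 + 1 :=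
        norm_sub_le_of_le (hC.norm_le_three hρ hm hw.le i k) (by
          fin_cases i <;> fin_cases k <;> simp)
      calc ‖(C w - 1) i k‖ * |w.im| ≤ (3 + 1) * (4 * (‖w‖ + 1) ^ 2 * mass C) := by gcongr
        _ ≤ 144 * ρ ^ 2 * mass C := by linarith
  calc ‖(C z - 1) i k‖ ≤ 8 * (144 * ρ ^ 2 * mass C) / (3 * (2 * ρ)) :=
        norm_le_of_forall_norm_mul_abs_im_le ((hC.inner.entire i k).sub_const _) (by linarith)
          hcircle (by linarith)
    _ = 192 * (ρ * mass C) := by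
        field_simp
        ring

theorem norm_sub_one_sub_interpolantAtI_le (hC : IsArovInner C) {z : ℂ}
    (hm : 400 * mass C ≤ 1) (hz : 200 * (‖z‖ * mass C) ≤ 1) (i k : Fin 2) :
    ‖(C z - 1) i k - interpolantAtI (fun v => (C v - 1) i k) z‖ ≤
      128000 * mass C ^ 2 * ‖z ^ 2 + 1‖ := by
  have hI (v : ℂ) (hv : ‖v‖ = 1) : ‖(C v - 1) i k‖ ≤ 192 * (1 * mass C) :=
    hC.norm_sub_one_le le_rfl (by linarith) hv.le i k
  rcases hC.mass_nonneg.eq_or_lt with h0 | h0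
  · have hzero (v : ℂ) : (C v - 1) i k = 0 := by
      have := hC.norm_sub_one_le (le_max_left 1 ‖v‖) (by rw [← h0]; norm_num)
        (le_max_right 1 ‖v‖) i k
      rwa [← h0, mul_zero, mul_zero, norm_le_zero_iff] at this
    simp [interpolantAtI, hzero, ← h0]
  set ρ := (200 * mass C)⁻¹ with hρ
  have hρm : 200 * (ρ * mass C) = 1 := by rw [hρ]; field_simp
  have hρ2 : 2 ≤ ρ := by nlinarith
  have hzρ : ‖z‖ ≤ ρ := by nlinarith
  have h := norm_sub_interpolantAtI_le ((hC.inner.entire i k).sub_const ((1 : Mat2) i k)) hρ2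
    (fun w hw => hC.norm_sub_one_le (by linarith) (by linarith) hw.le i k)
    (hI I norm_I) (hI (-I) (by rw [norm_neg, norm_I])) hzρ
  have hmass : mass C = (200 * ρ)⁻¹ := by rw [hρ]; field_simp
  rw [← le_div_iff₀ (by nlinarith)] at h
  refine h.trans ?_
  rw [mul_div_right_comm]
  gcongr
  rw [div_le_iff₀ (by nlinarith), hmass]
  field_simp
  nlinarith

end IsArovInner

/-! ### Families in Arov gauge -/

theorem inv_eq_of_det_eq_one {X : Mat2} (h : X.det = 1) :
    X⁻¹ = !![X 1 1, -X 0 1; -X 1 0, X 0 0] := by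
  rw [Matrix.inv_def, h, Ring.inverse_one, one_smul, Matrix.adjugate_fin_two]

/-- A continuous `j`-monotonic family of determinant one in Arov gauge on the interval `S`, equal
to the identity at `0`. -/
structure IsArovFamily (S : Set ℝ) (𝔄 : ℂ → ℝ → Mat2) : Prop where
  ordConnected : S.OrdConnected
  zero_mem : (0 : ℝ) ∈ S
  mono : IsJMonotonic jMat S 𝔄
  cont : IsContinuousFamily S 𝔄
  gauge : InArovGauge S 𝔄
  det : ∀ z, ∀ ℓ ∈ S, (𝔄 z ℓ).det = 1
  apply_zero : ∀ z, 𝔄 z 0 = 1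

/-- The transfer matrix `𝔄(z, s)⁻¹ 𝔄(z, t)` of the family between two parameters. -/
def transfer (𝔄 : ℂ → ℝ → Mat2) (s t : ℝ) (z : ℂ) : Mat2 := (𝔄 z s)⁻¹ * 𝔄 z t

/-- The logarithm of the upper diagonal entry at `i`; it turns out to be the distribution function
of the measure of the canonical system. -/
def logDiag (𝔄 : ℂ → ℝ → Mat2) (t : ℝ) : ℝ := Real.log (𝔄 I t 0 0).re

namespace IsArovFamily

variable {S : Set ℝ} {𝔄 : ℂ → ℝ → Mat2} {s t : ℝ}

theorem mul_transfer (h : IsArovFamily S 𝔄) (hs : s ∈ S) (t : ℝ) (z : ℂ) :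
    𝔄 z s * transfer 𝔄 s t z = 𝔄 z t :=
  Matrix.mul_nonsing_inv_cancel_left _ _ (h.det z s hs ▸ isUnit_one)

theorem transfer_self (h : IsArovFamily S 𝔄) (hs : s ∈ S) (z : ℂ) : transfer 𝔄 s s z = 1 :=
  Matrix.nonsing_inv_mul _ (h.det z s hs ▸ isUnit_one)

theorem transfer_zero_left (h : IsArovFamily S 𝔄) (t : ℝ) (z : ℂ) :
    transfer 𝔄 0 t z = 𝔄 z t := by
  rw [transfer, h.apply_zero, inv_one, one_mul]

theorem transfer_zero_right (h : IsArovFamily S 𝔄) (s : ℝ) (z : ℂ) :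
    transfer 𝔄 s 0 z = (𝔄 z s)⁻¹ := by
  rw [transfer, h.apply_zero, mul_one]

theorem inv_I (h : IsArovFamily S 𝔄) (ht : t ∈ S) :
    (𝔄 I t)⁻¹ = !![𝔄 I t 1 1, 0; -𝔄 I t 1 0, 𝔄 I t 0 0] := by
  rw [inv_eq_of_det_eq_one (h.det I t ht), (h.gauge t ht).1, neg_zero]

theorem transfer_I (h : IsArovFamily S 𝔄) (hs : s ∈ S) (ht : t ∈ S) :
    transfer 𝔄 s t I =
      !![𝔄 I s 1 1 * 𝔄 I t 0 0, 0;
        𝔄 I s 0 0 * 𝔄 I t 1 0 - 𝔄 I s 1 0 * 𝔄 I t 0 0, 𝔄 I s 0 0 * 𝔄 I t 1 1] := by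
  rw [transfer, h.inv_I hs, (𝔄 I t).eta_fin_two, (h.gauge t ht).1, Matrix.mul_fin_two]
  congr 1
  ext i k
  fin_cases i <;> fin_cases k <;> simp [sub_eq_neg_add]

theorem isArovInner_transfer (h : IsArovFamily S 𝔄) (hs : s ∈ S) (ht : t ∈ S)
    (hst : s ≤ t) : IsArovInner (transfer 𝔄 s t) where
  inner := by
    rcases hst.eq_or_lt with rfl | hlt
    · rw [funext (h.transfer_self hs)]
      refine ⟨fun i k => differentiable_const _, fun z _ => ?_, fun _ => ?_⟩
      · simpa using Matrix.PosSemidef.zero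
      · simp
    · exact h.mono s hs t ht hlt
  det z := by
    rw [transfer, Matrix.det_mul, h.det z t ht, mul_one, Matrix.det_nonsing_inv, h.det z s hs,
      Ring.inverse_one]
  zero := by rw [h.transfer_I hs ht]; rfl
  pos := by
    rw [h.transfer_I hs ht]
    exact mul_pos (h.gauge s hs).2.2 (h.gauge t ht).2.1

theorem apply_I_zero_zero (h : IsArovFamily S 𝔄) (ht : t ∈ S) :
    𝔄 I t 0 0 = (Real.exp (logDiag 𝔄 t) : ℂ) := by
  have hp := Complex.lt_def.1 (h.gauge t ht).2.1
  rw [logDiag, Real.exp_log hp.1]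
  exact Complex.ext rfl (by simpa using hp.2.symm)

theorem apply_I_one_one (h : IsArovFamily S 𝔄) (ht : t ∈ S) :
    𝔄 I t 1 1 = (Real.exp (-logDiag 𝔄 t) : ℂ) := by
  have hd := h.det I t ht
  rw [Matrix.det_fin_two, (h.gauge t ht).1, zero_mul, sub_zero, h.apply_I_zero_zero ht] at hd
  rw [Real.exp_neg, ofReal_inv]
  exact eq_inv_of_mul_eq_one_right hd

theorem logDiag_zero (h : IsArovFamily S 𝔄) : logDiag 𝔄 0 = 0 := by
  simp [logDiag, h.apply_zero]

theorem mass_transfer (h : IsArovFamily S 𝔄) (hs : s ∈ S) (ht : t ∈ S) :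
    mass (transfer 𝔄 s t) = logDiag 𝔄 t - logDiag 𝔄 s := by
  have hst : transfer 𝔄 s t I 0 0 = (Real.exp (-logDiag 𝔄 s + logDiag 𝔄 t) : ℂ) := by
    rw [h.transfer_I hs ht, Real.exp_add, ofReal_mul, ← h.apply_I_one_one hs,
      ← h.apply_I_zero_zero ht]
    rfl
  rw [mass, hst, norm_real, Real.norm_of_nonneg (Real.exp_pos _).le, Real.log_exp, neg_add_eq_sub]

theorem monotoneOn_logDiag (h : IsArovFamily S 𝔄) : MonotoneOn (logDiag 𝔄) S :=
  fun _ hs _ ht hst => sub_nonneg.1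
    (h.mass_transfer hs ht ▸ (h.isArovInner_transfer hs ht hst).mass_nonneg)

theorem antitoneOn_apply_I_one_one (h : IsArovFamily S 𝔄) :
    AntitoneOn (fun t => (𝔄 I t 1 1).re) S := fun s hs t ht hst => by
  simp only [h.apply_I_one_one hs, h.apply_I_one_one ht, ofReal_re]
  exact Real.exp_le_exp.2 (neg_le_neg (h.monotoneOn_logDiag hs ht hst))

theorem continuousOn_apply (h : IsArovFamily S 𝔄) (z : ℂ) (i k : Fin 2) :
    ContinuousOn (fun t => 𝔄 z t i k) S :=
  (continuous_apply_apply i k).comp_continuousOn (h.cont z)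

theorem continuousOn_logDiag (h : IsArovFamily S 𝔄) : ContinuousOn (logDiag 𝔄) S :=
  ContinuousOn.log (continuous_re.comp_continuousOn (h.continuousOn_apply I 0 0))
    fun t ht => (Complex.lt_def.1 (h.gauge t ht).2.1).1.ne'

theorem norm_apply_le_exp (h : IsArovFamily S 𝔄) (ht : t ∈ S) {ρ : ℝ} (hρ : 1 ≤ ρ) {z : ℂ}
    (hz : ‖z‖ ≤ ρ) (i k : Fin 2) : ‖𝔄 z t i k‖ ≤ Real.exp (162 * ρ * |logDiag 𝔄 t|) := by
  rcases le_total 0 t with h0 | h0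
  · have hb := (h.isArovInner_transfer h.zero_mem ht h0).norm_le_exp hρ (z := z)
      (by linarith) i k
    rw [h.mass_transfer h.zero_mem ht, h.logDiag_zero, sub_zero, h.transfer_zero_left] at hb
    exact hb.trans (Real.exp_le_exp.2 (by gcongr; exact le_abs_self _))
  · have hb := (h.isArovInner_transfer ht h.zero_mem h0).norm_le_exp hρ (z := z)
      (by linarith) k.rev i.rev
    rw [h.mass_transfer ht h.zero_mem, h.logDiag_zero, zero_sub, h.transfer_zero_right,
      inv_eq_of_det_eq_one (h.det z t ht)] at hb
    refine le_trans (le_of_eq ?_) (hb.trans (Real.exp_le_exp.2 (by gcongr; exact neg_le_abs _)))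
    fin_cases i <;> fin_cases k <;> simp

theorem norm_apply_sub_apply_le (h : IsArovFamily S 𝔄) (hs : s ∈ S) (ht : t ∈ S) {ρ M : ℝ}
    (hρ : 1 ≤ ρ) {z : ℂ} (hz : ‖z‖ ≤ ρ) (hsM : |logDiag 𝔄 s| ≤ M) (htM : |logDiag 𝔄 t| ≤ M)
    (i k : Fin 2) : ‖𝔄 z t i k - 𝔄 z s i k‖ ≤
      400 * ρ * Real.exp (162 * ρ * M) * |logDiag 𝔄 t - logDiag 𝔄 s| := by
  wlog hst : s ≤ t generalizing s t
  · rw [norm_sub_rev, abs_sub_comm]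
    exact this ht hs htM hsM (le_of_not_ge hst)
  set B := Real.exp (162 * ρ * M)
  have hB (r : ℝ) (hr : r ∈ S) (hrM : |logDiag 𝔄 r| ≤ M) (i k : Fin 2) : ‖𝔄 z r i k‖ ≤ B :=
    (h.norm_apply_le_exp hr hρ hz i k).trans (Real.exp_le_exp.2 (by gcongr))
  have hΔ := sub_nonneg.2 (h.monotoneOn_logDiag hs ht hst)
  rw [abs_of_nonneg hΔ]
  set Δ := logDiag 𝔄 t - logDiag 𝔄 s
  rcases le_total (ρ * Δ) (1 / 200) with hsmall | hlarge
  · have hT (l : Fin 2) : ‖(transfer 𝔄 s t z - 1) l k‖ ≤ 192 * (ρ * Δ) := by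
      have := (h.isArovInner_transfer hs ht hst).norm_sub_one_le hρ (z := z)
        (by rwa [h.mass_transfer hs ht]) hz l k
      rwa [h.mass_transfer hs ht] at this
    have e : 𝔄 z t i k - 𝔄 z s i k = 𝔄 z s i 0 * (transfer 𝔄 s t z - 1) 0 k +
        𝔄 z s i 1 * (transfer 𝔄 s t z - 1) 1 k := by
      rw [← Fin.sum_univ_two (fun l => 𝔄 z s i l * (transfer 𝔄 s t z - 1) l k),
        ← Matrix.mul_apply, mul_sub, h.mul_transfer hs, mul_one, Matrix.sub_apply]
    calc ‖𝔄 z t i k - 𝔄 z s i k‖ ≤ B * (192 * (ρ * Δ)) + B * (192 * (ρ * Δ)) := e ▸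
          norm_add_le_of_le (norm_mul_le_of_le (hB s hs hsM i 0) (hT 0))
            (norm_mul_le_of_le (hB s hs hsM i 1) (hT 1))
      _ = 384 * (ρ * Δ * B) := by ring
      _ ≤ 400 * (ρ * Δ * B) := by gcongr; norm_num
      _ = 400 * ρ * B * Δ := by ring
  · calc ‖𝔄 z t i k - 𝔄 z s i k‖ ≤ B + B :=
          norm_sub_le_of_le (hB t ht htM i k) (hB s hs hsM i k)
      _ = 400 * (1 / 200) * B := by ring
      _ ≤ 400 * (ρ * Δ) * B := by gcongr
      _ = 400 * ρ * B * Δ := by ring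

theorem apply_eq_of_logDiag_eq (h : IsArovFamily S 𝔄) (hs : s ∈ S) (ht : t ∈ S)
    (hst : logDiag 𝔄 s = logDiag 𝔄 t) (z : ℂ) : 𝔄 z s = 𝔄 z t := by
  ext i k
  have := h.norm_apply_sub_apply_le ht hs (le_max_left 1 ‖z‖) (le_max_right 1 ‖z‖) le_rfl
    (hst ▸ le_rfl) i k
  rwa [hst, sub_self, abs_zero, mul_zero, norm_le_zero_iff, sub_eq_zero] at this

end IsArovFamily

/-! ### Atomless measures on an interval -/

theorem map_restrict_Icc_eq_volume_restrict {μ : Measure ℝ} {m : ℝ → ℝ} {a b : ℝ} (hab : a ≤ b)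
    (hm : MonotoneOn m (Icc a b)) (hc : ContinuousOn m (Icc a b))
    (hμ : ∀ t ∈ Icc a b, μ (Icc a t) = ENNReal.ofReal (m t - m a)) :
    Measure.map m (μ.restrict (Icc a b)) = volume.restrict (Icc (m a) (m b)) := by
  have ha : a ∈ Icc a b := left_mem_Icc.2 hab
  have hb : b ∈ Icc a b := right_mem_Icc.2 hab
  have hfin : IsFiniteMeasure (μ.restrict (Icc a b)) :=
    ⟨by rw [Measure.restrict_apply_univ, hμ b hb]; exact ENNReal.ofReal_lt_top⟩
  refine Measure.ext_of_Iic _ _ fun x => ?_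
  have hvol : volume (Iic x ∩ Icc (m a) (m b)) = ENNReal.ofReal (min (m b) x - m a) := by
    rw [inter_comm, ← Ici_inter_Iic, inter_assoc, Iic_inter_Iic, Ici_inter_Iic, Real.volume_Icc]
  rw [Measure.map_apply_of_aemeasurable (hc.aemeasurable measurableSet_Icc) measurableSet_Iic,
    Measure.restrict_apply' measurableSet_Icc, Measure.restrict_apply measurableSet_Iic, hvol,
    inter_comm]
  rcases lt_or_ge x (m a) with hx | hx
  · have hempty : Icc a b ∩ m ⁻¹' Iic x = ∅ :=
      eq_empty_of_forall_notMem fun t ht => (hm ha ht.1 ht.1.1).not_gt (ht.2.trans_lt hx)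
    rw [hempty, measure_empty, ENNReal.ofReal_of_nonpos
      (sub_nonpos.2 ((min_le_right _ _).trans hx.le))]
  · have hcpt : IsCompact (Icc a b ∩ m ⁻¹' Iic x) :=
      isCompact_Icc.of_isClosed_subset (hc.preimage_isClosed_of_isClosed isClosed_Icc isClosed_Iic)
        inter_subset_left
    obtain ⟨c, ⟨hcab, hcx⟩, hmax⟩ := hcpt.exists_isGreatest ⟨a, ha, hx⟩
    have hset : Icc a b ∩ m ⁻¹' Iic x = Icc a c := by
      ext t
      refine ⟨fun ht => ⟨ht.1.1, hmax ht⟩, fun ht => ?_⟩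
      have htab : t ∈ Icc a b := ⟨ht.1, ht.2.trans hcab.2⟩
      exact ⟨htab, (hm htab hcab ht.2).trans hcx⟩
    have hmc : m c = min (m b) x := by
      refine le_antisymm (le_min (hm hcab hb hcab.2) hcx) ?_
      by_contra! hlt
      obtain ⟨d, hd, hmd⟩ := intermediate_value_Icc hcab.2 (hc.mono (Icc_subset_Icc_left hcab.1))
        ⟨hlt.le, min_le_left _ _⟩
      have hdc := hmax ⟨⟨hcab.1.trans hd.1, hd.2⟩, hmd.trans_le (min_le_right _ _)⟩
      exact (hmd.symm.trans_le (hm ⟨hcab.1.trans hd.1, hd.2⟩ hcab hdc)).not_gt hlt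
    rw [hset, hμ c hcab, hmc]

/-- A Borel measure carried by `S`, without atoms and finite on the compact subintervals of `S`. -/
structure IsContinuousMeasure (S : Set ℝ) (μ : Measure ℝ) : Prop where
  carried : μ Sᶜ = 0
  singleton : ∀ t, μ {t} = 0
  finite : ∀ a ∈ S, ∀ b ∈ S, μ (Icc a b) < ⊤

/-- `F` is a primitive of `p` on `S` with respect to `μ`: the scalar version of `HasRNDeriv`. -/
structure HasScalarRNDeriv (S : Set ℝ) (μ : Measure ℝ) (F p : ℝ → ℂ) : Prop where
  integrableOn : ∀ a ∈ S, ∀ b ∈ S, IntegrableOn p (Icc a b) μ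
  sub_eq : ∀ a ∈ S, ∀ b ∈ S, F b - F a = ∫ t in a..b, p t ∂μ

namespace IsContinuousMeasure

variable {S : Set ℝ} {μ : Measure ℝ}

theorem nullSingletonClass (hμ : IsContinuousMeasure S μ) : NullSingletonClass μ :=
  ⟨hμ.singleton⟩

theorem ae_mem (hμ : IsContinuousMeasure S μ) : ∀ᵐ t ∂μ, t ∈ S := by
  rw [ae_iff]
  exact hμ.carried

end IsContinuousMeasure

theorem integral_mul_integral_eq_add {ρ : Measure ℝ} [SFinite ρ]
    [NullSingletonClass ρ] {p q : ℝ → ℂ} (hp : Integrable p ρ) (hq : Integrable q ρ) :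
    (∫ t, p t ∂ρ) * ∫ t, q t ∂ρ =
      ∫ t, p t * (∫ s in Iic t, q s ∂ρ) ∂ρ + ∫ t, q t * (∫ s in Iic t, p s ∂ρ) ∂ρ := by
  set K : Set (ℝ × ℝ) := {x | x.2 ≤ x.1} with hK
  have hKm : MeasurableSet K := measurableSet_le measurable_snd measurable_fst
  have hpq : Integrable (fun x : ℝ × ℝ => p x.1 * q x.2) (ρ.prod ρ) := hp.mul_prod hq
  have hlower : ∫ x in K, p x.1 * q x.2 ∂(ρ.prod ρ) = ∫ t, p t * (∫ s in Iic t, q s ∂ρ) ∂ρ := by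
    rw [← integral_indicator hKm, integral_prod _ (hpq.indicator hKm)]
    refine integral_congr_ae (ae_of_all _ fun t => ?_)
    dsimp only
    rw [← integral_const_mul, ← integral_indicator measurableSet_Iic]
    rfl
  have hupper : ∫ x in Kᶜ, p x.1 * q x.2 ∂(ρ.prod ρ) =
      ∫ t, q t * (∫ s in Iic t, p s ∂ρ) ∂ρ := by
    rw [← integral_indicator hKm.compl, integral_prod_symm _ (hpq.indicator hKm.compl)]
    refine integral_congr_ae (ae_of_all _ fun t => ?_)
    dsimp only
    rw [mul_comm, integral_Iic_eq_integral_Iio, ← integral_mul_const,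
      ← integral_indicator measurableSet_Iio]
    refine integral_congr_ae (ae_of_all _ fun s => ?_)
    simp only [indicator, hK, mem_compl_iff, mem_ofPred_eq, not_le, mem_Iio]
  rw [← integral_prod_mul, ← integral_add_compl hKm hpq, hlower, hupper]

theorem ae_eq_of_forall_setIntegral_Iic_eq {ρ : Measure ℝ} {p q : ℝ → ℂ} (hp : Integrable p ρ)
    (hq : Integrable q ρ) (hpq : ∀ c, ∫ t in Iic c, p t ∂ρ = ∫ t in Iic c, q t ∂ρ) :
    p =ᵐ[ρ] q := by
  have huniv : ∫ t, p t ∂ρ = ∫ t, q t ∂ρ :=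
    tendsto_nhds_unique ((aecover_Iic tendsto_id).integral_tendsto_of_countably_generated hp) <| by
      simpa only [hpq] using (aecover_Iic tendsto_id).integral_tendsto_of_countably_generated hq
  refine hp.ae_eq_of_withDensityᵥ_eq hq (VectorMeasure.ext_of_generateFrom (range Iic) ?_
    (borel_eq_generateFrom_Iic ℝ ▸ BorelSpace.measurable_eq) isPiSystem_Iic ?_)
  · rintro _ ⟨c, rfl⟩
    rw [withDensityᵥ_apply hp measurableSet_Iic, withDensityᵥ_apply hq measurableSet_Iic, hpq]
  · rw [withDensityᵥ_apply hp MeasurableSet.univ, withDensityᵥ_apply hq MeasurableSet.univ,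
      setIntegral_univ, setIntegral_univ, huniv]

namespace HasScalarRNDeriv

variable {S : Set ℝ} {μ : Measure ℝ} {F G p q : ℝ → ℂ}

theorem continuousOn (hF : HasScalarRNDeriv S μ F p) (hμ : IsContinuousMeasure S μ)
    (hS : S.OrdConnected) {a b : ℝ} (ha : a ∈ S) (hb : b ∈ S) : ContinuousOn F (Icc a b) := by
  rcases lt_or_ge b a with hab | hab
  · simp only [Icc_eq_empty_of_lt hab, continuousOn_empty]
  have := hμ.nullSingletonClass
  have hprim := intervalIntegral.continuousOn_primitive_interval
    ((uIcc_of_le hab).symm ▸ hF.integrableOn a ha b hb)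
  rw [uIcc_of_le hab] at hprim
  exact ((continuousOn_const (c := F a)).add hprim).congr fun t ht =>
    sub_eq_iff_eq_add'.1 (hF.sub_eq a ha t (hS.out ha hb ht))

theorem congr (hF : HasScalarRNDeriv S μ F p) (hFG : EqOn F G S) (hpq : p =ᵐ[μ] q) :
    HasScalarRNDeriv S μ G q where
  integrableOn a ha b hb := (hF.integrableOn a ha b hb).congr (ae_restrict_of_ae hpq)
  sub_eq a ha b hb := by
    rw [← hFG ha, ← hFG hb, hF.sub_eq a ha b hb]
    exact intervalIntegral.integral_congr_ae_restrict (ae_restrict_of_ae hpq)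

theorem integral_mul_setIntegral_Iic (hG : HasScalarRNDeriv S μ G q)
    (hμ : IsContinuousMeasure S μ) (hS : S.OrdConnected) {a b : ℝ} (ha : a ∈ S) (hb : b ∈ S)
    (hab : a ≤ b) (hp : IntegrableOn p (Icc a b) μ) :
    ∫ t in Ioc a b, p t * (∫ s in Iic t, q s ∂(μ.restrict (Ioc a b))) ∂μ =
      ∫ t in a..b, p t * G t ∂μ - (∫ t in a..b, p t ∂μ) * G a := by
  have hpG := (hp.mul_continuousOn (hG.continuousOn hμ hS ha hb) isCompact_Icc).mono_set
    Ioc_subset_Icc_self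
  rw [intervalIntegral.integral_of_le hab, intervalIntegral.integral_of_le hab,
    ← integral_mul_const, ← integral_sub hpG ((hp.mono_set Ioc_subset_Icc_self).mul_const _)]
  refine setIntegral_congr_fun measurableSet_Ioc fun t ht => ?_
  have hprim : ∫ s in Iic t, q s ∂(μ.restrict (Ioc a b)) = G t - G a := by
    rw [hG.sub_eq a ha t (hS.out ha hb ⟨ht.1.le, ht.2⟩), intervalIntegral.integral_of_le ht.1.le,
      Measure.restrict_restrict measurableSet_Iic, inter_comm, Ioc_inter_Iic, min_eq_right ht.2]
  simp only [hprim, mul_sub]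

theorem mul (hF : HasScalarRNDeriv S μ F p) (hG : HasScalarRNDeriv S μ G q)
    (hμ : IsContinuousMeasure S μ) (hS : S.OrdConnected) :
    HasScalarRNDeriv S μ (fun t => F t * G t) fun t => p t * G t + q t * F t := by
  have := hμ.nullSingletonClass
  have hpG : ∀ a ∈ S, ∀ b ∈ S, IntegrableOn (fun t => p t * G t) (Icc a b) μ := fun a ha b hb =>
    (hF.integrableOn a ha b hb).mul_continuousOn (hG.continuousOn hμ hS ha hb) isCompact_Icc
  have hqF : ∀ a ∈ S, ∀ b ∈ S, IntegrableOn (fun t => q t * F t) (Icc a b) μ := fun a ha b hb =>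
    (hG.integrableOn a ha b hb).mul_continuousOn (hF.continuousOn hμ hS ha hb) isCompact_Icc
  refine ⟨fun a ha b hb => (hpG a ha b hb).add (hqF a ha b hb), fun a ha b hb => ?_⟩
  wlog hab : a ≤ b generalizing a b
  · rw [intervalIntegral.integral_symm, ← this b hb a ha (le_of_not_ge hab), neg_sub]
  have hfin : IsFiniteMeasure (μ.restrict (Ioc a b)) :=
    isFiniteMeasure_restrict.2 <|
      ((measure_mono Ioc_subset_Icc_self).trans_lt (hμ.finite a ha b hb)).ne
  have hp := hF.integrableOn a ha b hb
  have hq := hG.integrableOn a ha b hb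
  have hfubini := integral_mul_integral_eq_add (hp.mono_set Ioc_subset_Icc_self)
    (hq.mono_set Ioc_subset_Icc_self)
  rw [hG.integral_mul_setIntegral_Iic hμ hS ha hb hab hp,
    hF.integral_mul_setIntegral_Iic hμ hS ha hb hab hq, ← intervalIntegral.integral_of_le hab,
    ← intervalIntegral.integral_of_le hab, ← hF.sub_eq a ha b hb, ← hG.sub_eq a ha b hb] at hfubini
  rw [intervalIntegral.integral_add
    ((intervalIntegrable_iff_integrableOn_Icc_of_le hab).2 (hpG a ha b hb))
    ((intervalIntegrable_iff_integrableOn_Icc_of_le hab).2 (hqF a ha b hb))]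
  linear_combination hfubini

theorem ae_eq (hp : HasScalarRNDeriv S μ F p) (hq : HasScalarRNDeriv S μ F q)
    (hμ : IsContinuousMeasure S μ) (hS : S.OrdConnected) : p =ᵐ[μ] q := by
  have := hμ.nullSingletonClass
  have hmem : ∀ᵐ t ∂μ, t ∈ S → p t = q t := by
    refine ae_of_mem_of_ae_of_mem_inter_Ioo fun a b ha hb _ => ?_
    have hae : p =ᵐ[μ.restrict (Icc a b)] q := by
      refine ae_eq_of_forall_setIntegral_Iic_eq (hp.integrableOn a ha b hb)
        (hq.integrableOn a ha b hb) fun c => ?_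
      rw [Measure.restrict_restrict measurableSet_Iic, inter_comm, ← Ici_inter_Iic, inter_assoc,
        Iic_inter_Iic, Ici_inter_Iic]
      rcases lt_or_ge (min b c) a with hc | hc
      · rw [Icc_eq_empty_of_lt hc, setIntegral_empty, setIntegral_empty]
      · have hcS := hS.out ha hb ⟨hc, min_le_left _ _⟩
        rw [integral_Icc_eq_integral_Ioc, integral_Icc_eq_integral_Ioc,
          ← intervalIntegral.integral_of_le hc, ← intervalIntegral.integral_of_le hc,
          ← hp.sub_eq a ha _ hcS, ← hq.sub_eq a ha _ hcS]
    filter_upwards [(ae_restrict_iff' measurableSet_Icc).1 hae] with t ht htS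
    exact ht (Ioo_subset_Icc_self htS.2)
  filter_upwards [hmem, hμ.ae_mem] with t ht htS using ht htS

theorem ofReal_of_measureReal_Icc {m : ℝ → ℝ} (hμ : IsContinuousMeasure S μ)
    (hm : ∀ a ∈ S, ∀ b ∈ S, a ≤ b → μ.real (Icc a b) = m b - m a) :
    HasScalarRNDeriv S μ (fun t => (m t : ℂ)) fun _ => 1 := by
  have := hμ.nullSingletonClass
  refine ⟨fun a ha b hb => integrableOn_const (hμ.finite a ha b hb).ne, fun a ha b hb => ?_⟩
  wlog hab : a ≤ b generalizing a b
  · rw [intervalIntegral.integral_symm, ← this b hb a ha (le_of_not_ge hab), neg_sub]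
  rw [intervalIntegral.integral_of_le hab, ← integral_Icc_eq_integral_Ioc, setIntegral_const,
    hm a ha b hb hab, real_smul, mul_one, ofReal_sub]

theorem comp {m : ℝ → ℝ} (hF : HasScalarRNDeriv (m '' S) volume F p)
    (hμ : IsContinuousMeasure S μ) (hS : S.OrdConnected)
    (hm : ∀ a ∈ S, ∀ b ∈ S, a ≤ b → μ.real (Icc a b) = m b - m a) :
    HasScalarRNDeriv S μ (fun t => F (m t)) fun t => p (m t) := by
  have := hμ.nullSingletonClass
  have hmem : ∀ {a}, a ∈ S → m a ∈ m '' S := fun ha => mem_image_of_mem m ha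
  have hmono : MonotoneOn m S := fun a ha b hb hab =>
    sub_nonneg.1 (hm a ha b hb hab ▸ measureReal_nonneg)
  have hmap : ∀ a ∈ S, ∀ b ∈ S, a ≤ b → AEMeasurable m (μ.restrict (Icc a b)) ∧
      Measure.map m (μ.restrict (Icc a b)) = volume.restrict (Icc (m a) (m b)) := by
    intro a ha b hb hab
    have hc : ContinuousOn m (Icc a b) := continuous_re.comp_continuousOn
      ((ofReal_of_measureReal_Icc hμ hm).continuousOn hμ hS ha hb)
    refine ⟨hc.aemeasurable measurableSet_Icc,
      map_restrict_Icc_eq_volume_restrict hab (hmono.mono (hS.out ha hb)) hc fun t ht => ?_⟩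
    have htS := hS.out ha hb ht
    rw [← hm a ha t htS ht.1, ofReal_measureReal (hμ.finite a ha t htS).ne]
  refine ⟨fun a ha b hb => ?_, fun a ha b hb => ?_⟩
  · rcases lt_or_ge b a with hab | hab
    · simp only [Icc_eq_empty_of_lt hab, integrableOn_empty]
    obtain ⟨hmeas, heq⟩ := hmap a ha b hb hab
    have hint := hF.integrableOn _ (hmem ha) _ (hmem hb)
    rw [IntegrableOn, ← heq] at hint
    exact hint.comp_aemeasurable hmeas
  · wlog hab : a ≤ b generalizing a b
    · rw [intervalIntegral.integral_symm, ← this b hb a ha (le_of_not_ge hab), neg_sub]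
    obtain ⟨hmeas, heq⟩ := hmap a ha b hb hab
    have hint := hF.integrableOn _ (hmem ha) _ (hmem hb)
    rw [hF.sub_eq _ (hmem ha) _ (hmem hb), intervalIntegral.integral_of_le hab,
      intervalIntegral.integral_of_le (hmono ha hb hab), ← integral_Icc_eq_integral_Ioc,
      ← integral_Icc_eq_integral_Ioc, ← heq,
      integral_map hmeas (heq ▸ hint.aestronglyMeasurable)]

end HasScalarRNDeriv

section Pullback

variable {S : Set ℝ} {m : ℝ → ℝ}

/-- The measure on `S` with distribution function `m`: the image of Lebesgue measure under a right
inverse of `m`. -/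
def pullbackMeasure (m : ℝ → ℝ) (S : Set ℝ) : Measure ℝ :=
  Measure.map (Function.invFunOn m S) (volume.restrict (m '' S))

theorem ordConnected_image (hS : S.OrdConnected) (hc : ContinuousOn m S) :
    (m '' S).OrdConnected :=
  ((isPreconnected_iff_ordConnected.2 hS).image m hc).ordConnected

theorem strictMonoOn_invFunOn (hm : MonotoneOn m S) :
    StrictMonoOn (Function.invFunOn m S) (m '' S) := by
  intro x hx y hy hxy
  by_contra! hle
  have hyx := hm (Function.invFunOn_mem hy) (Function.invFunOn_mem hx) hle
  rw [Function.invFunOn_eq hx, Function.invFunOn_eq hy] at hyx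
  exact hxy.not_ge hyx

theorem aemeasurable_invFunOn (hS : S.OrdConnected) (hc : ContinuousOn m S) (hm : MonotoneOn m S) :
    AEMeasurable (Function.invFunOn m S) (volume.restrict (m '' S)) :=
  aemeasurable_restrict_of_monotoneOn (ordConnected_image hS hc).measurableSet
    (strictMonoOn_invFunOn hm).monotoneOn

theorem pullbackMeasure_Icc (hS : S.OrdConnected) (hc : ContinuousOn m S) (hm : MonotoneOn m S)
    {a b : ℝ} (ha : a ∈ S) (hb : b ∈ S) :
    pullbackMeasure m S (Icc a b) = ENNReal.ofReal (m b - m a) := by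
  have hJ := ordConnected_image hS hc
  rw [pullbackMeasure, Measure.map_apply_of_aemeasurable (aemeasurable_invFunOn hS hc hm)
    measurableSet_Icc, Measure.restrict_apply' hJ.measurableSet]
  apply le_antisymm
  · rw [← Real.volume_Icc]
    refine measure_mono fun x ⟨⟨hax, hxb⟩, hxJ⟩ => ?_
    rw [← Function.invFunOn_eq hxJ]
    exact ⟨hm ha (Function.invFunOn_mem hxJ) hax, hm (Function.invFunOn_mem hxJ) hb hxb⟩
  · rw [← Real.volume_Ioo]
    refine measure_mono fun x hx => ?_
    have hxJ : x ∈ m '' S :=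
      hJ.out (mem_image_of_mem m ha) (mem_image_of_mem m hb) (Ioo_subset_Icc_self hx)
    rw [← Function.invFunOn_eq hxJ] at hx
    refine ⟨⟨?_, ?_⟩, hxJ⟩ <;> by_contra! hlt
    · exact hx.1.not_ge (hm (Function.invFunOn_mem hxJ) ha hlt.le)
    · exact hx.2.not_ge (hm hb (Function.invFunOn_mem hxJ) hlt.le)

theorem isContinuousMeasure_pullbackMeasure (hS : S.OrdConnected) (hc : ContinuousOn m S)
    (hm : MonotoneOn m S) : IsContinuousMeasure S (pullbackMeasure m S) := by
  have hcar : pullbackMeasure m S Sᶜ = 0 := by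
    rw [pullbackMeasure, Measure.map_apply_of_aemeasurable (aemeasurable_invFunOn hS hc hm)
      hS.measurableSet.compl, Measure.restrict_apply' (ordConnected_image hS hc).measurableSet]
    exact measure_mono_null (fun x ⟨hx, hxJ⟩ => hx (Function.invFunOn_mem hxJ)) measure_empty
  refine ⟨hcar, fun t => ?_, fun a ha b hb => ?_⟩
  · by_cases ht : t ∈ S
    · rw [← Icc_self, pullbackMeasure_Icc hS hc hm ht ht, sub_self, ENNReal.ofReal_zero]
    · exact measure_mono_null (singleton_subset_iff.2 ht) hcar
  · rw [pullbackMeasure_Icc hS hc hm ha hb]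
    exact ENNReal.ofReal_lt_top

theorem map_pullbackMeasure (hS : S.OrdConnected) (hc : ContinuousOn m S) (hm : MonotoneOn m S) :
    AEMeasurable m (pullbackMeasure m S) ∧
      Measure.map m (pullbackMeasure m S) = volume.restrict (m '' S) := by
  have hσ := aemeasurable_invFunOn hS hc hm
  have hmeas : AEMeasurable m (pullbackMeasure m S) := by
    rw [← Measure.restrict_eq_self_of_ae_mem (isContinuousMeasure_pullbackMeasure hS hc hm).ae_mem]
    exact hc.aemeasurable hS.measurableSet
  refine ⟨hmeas, ?_⟩
  rw [pullbackMeasure, AEMeasurable.map_map_of_aemeasurable hmeas hσ]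
  refine (Measure.map_congr ?_).trans Measure.map_id
  filter_upwards [ae_restrict_mem (ordConnected_image hS hc).measurableSet] with x hx
  exact Function.invFunOn_eq hx

end Pullback

theorem intervalIntegrable_deriv_and_integral_deriv_eq_sub {F : ℝ → ℂ} {K : NNReal} {a b : ℝ}
    (hF : LipschitzOnWith K F (uIcc a b)) :
    IntervalIntegrable (deriv F) volume a b ∧ ∫ x in a..b, deriv F x = F b - F a := by
  have hre : AbsolutelyContinuousOnInterval (fun x => (F x).re) a b :=
    (reCLM.lipschitz.comp_lipschitzOnWith hF).absolutelyContinuousOnInterval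
  have him : AbsolutelyContinuousOnInterval (fun x => (F x).im) a b :=
    (imCLM.lipschitz.comp_lipschitzOnWith hF).absolutelyContinuousOnInterval
  have hofReal {f : ℝ → ℝ} (hf : IntervalIntegrable f volume a b) :
      IntervalIntegrable (fun x => (f x : ℂ)) volume a b := ⟨hf.1.ofReal, hf.2.ofReal⟩
  have hre' := hofReal hre.intervalIntegrable_deriv
  have him' := (hofReal him.intervalIntegrable_deriv).mul_const I
  have hae : (fun x => ((deriv (fun y => (F y).re) x : ℝ) : ℂ) +
        ((deriv (fun y => (F y).im) x : ℝ) : ℂ) * I)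
      =ᵐ[volume.restrict (uIoc a b)] deriv F := by
    refine (ae_restrict_iff' measurableSet_uIoc).2 ?_
    filter_upwards [hre.ae_differentiableAt, him.ae_differentiableAt] with x hxre hxim hx
    have hd := (hxre (uIoc_subset_uIcc hx)).hasDerivAt.ofReal_comp.add
      ((hxim (uIoc_subset_uIcc hx)).hasDerivAt.ofReal_comp.mul_const I)
    refine (hd.congr_of_eventuallyEq (Eventually.of_forall fun y => ?_)).deriv.symm
    exact (re_add_im (F y)).symm
  refine ⟨(hre'.add him').congr_ae hae, ?_⟩
  rw [← intervalIntegral.integral_congr_ae_restrict hae, intervalIntegral.integral_add hre' him',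
    intervalIntegral.integral_mul_const, intervalIntegral.integral_ofReal,
    intervalIntegral.integral_ofReal, hre.integral_deriv_eq_sub, him.integral_deriv_eq_sub]
  exact Complex.ext (by simp) (by simp)

theorem hasScalarRNDeriv_volume_of_lipschitzOnWith {S : Set ℝ} {F p : ℝ → ℂ}
    (hS : S.OrdConnected)
    (hF : ∀ a ∈ S, ∀ b ∈ S, ∃ K, LipschitzOnWith K F (Icc a b))
    (hp : ∀ᵐ x, x ∈ S → deriv F x = p x) : HasScalarRNDeriv S volume F p := by
  have hpab : ∀ a ∈ S, ∀ b ∈ S, deriv F =ᵐ[volume.restrict (uIoc a b)] p := fun a ha b hb => by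
    refine (ae_restrict_iff' measurableSet_uIoc).2 ?_
    filter_upwards [hp] with x hx hxab using hx (hS.uIcc_subset ha hb (uIoc_subset_uIcc hxab))
  have hftc : ∀ a ∈ S, ∀ b ∈ S, a ≤ b →
      IntervalIntegrable p volume a b ∧ F b - F a = ∫ x in a..b, p x := fun a ha b hb hab => by
    obtain ⟨K, hK⟩ := hF a ha b hb
    rw [← uIcc_of_le hab] at hK
    obtain ⟨hint, heq⟩ := intervalIntegrable_deriv_and_integral_deriv_eq_sub hK
    exact ⟨hint.congr_ae (hpab a ha b hb), by
      rw [← heq, intervalIntegral.integral_congr_ae_restrict (hpab a ha b hb)]⟩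
  refine ⟨fun a ha b hb => ?_, fun a ha b hb => ?_⟩
  · rcases lt_or_ge b a with hab | hab
    · simp only [Icc_eq_empty_of_lt hab, integrableOn_empty]
    exact (intervalIntegrable_iff_integrableOn_Icc_of_le hab).1 (hftc a ha b hb hab).1
  · rcases le_total a b with hab | hab
    · exact (hftc a ha b hb hab).2
    · rw [intervalIntegral.integral_symm, ← (hftc b hb a ha hab).2, neg_sub]

theorem hasRNDeriv_iff {S : Set ℝ} {μ : Measure ℝ} {F D : ℝ → Mat2} :
    HasRNDeriv S μ F D ↔ ∀ i k, HasScalarRNDeriv S μ (fun t => F t i k) fun t => D t i k :=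
  ⟨fun h i k => ⟨fun a ha b hb => h.1 a ha b hb i k,
    fun a ha b hb => congrFun₂ (h.2 a ha b hb) i k⟩,
  fun h => ⟨fun a ha b hb i k => (h i k).integrableOn a ha b hb,
    fun a ha b hb => Matrix.ext fun i k => (h i k).sub_eq a ha b hb⟩⟩

theorem HasRNDeriv.ae_eq {S : Set ℝ} {μ : Measure ℝ} {F D D' : ℝ → Mat2}
    (hD : HasRNDeriv S μ F D) (hD' : HasRNDeriv S μ F D') (hμ : IsContinuousMeasure S μ)
    (hS : S.OrdConnected) : D =ᵐ[μ] D' := by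
  have hentry : ∀ᵐ t ∂μ, ∀ i k, D t i k = D' t i k := ae_all_iff.2 fun i => ae_all_iff.2 fun k =>
    (hasRNDeriv_iff.1 hD i k).ae_eq (hasRNDeriv_iff.1 hD' i k) hμ hS
  filter_upwards [hentry] with t ht using Matrix.ext ht

theorem mul_jMat_apply (X : Mat2) (i k : Fin 2) : (X * jMat) i k = X i k * jMat k k := by
  fin_cases k <;> simp [jMat, Matrix.mul_apply]

theorem HasRNDeriv.mul_jMat {S : Set ℝ} {μ : Measure ℝ} {F D : ℝ → Mat2}
    (h : HasRNDeriv S μ F D) :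
    HasRNDeriv S μ (fun t => F t * jMat) fun t => D t * jMat := by
  refine hasRNDeriv_iff.2 fun i k => ?_
  obtain ⟨hint, hsub⟩ := hasRNDeriv_iff.1 h i k
  simp only [mul_jMat_apply]
  exact ⟨fun a ha b hb => (hint a ha b hb).mul_const _, fun a ha b hb => by
    rw [intervalIntegral.integral_mul_const, ← hsub a ha b hb, sub_mul]⟩

/-! ### The canonical system of a family -/

/-- The coefficient matrix `i z A - B` of the canonical system. -/
def coeffM (𝔞 : ℝ → ℂ) (z : ℂ) (t : ℝ) : Mat2 := (I * z) • coeffA 𝔞 t - coeffB 𝔞 t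

theorem coeffM_eq (𝔞 : ℝ → ℂ) (z : ℂ) (t : ℝ) :
    coeffM 𝔞 z t = !![I * z, -(1 + I * z) * star (𝔞 t); (1 - I * z) * 𝔞 t, I * z] := by
  ext i k
  fin_cases i <;> fin_cases k <;> simp [coeffM, coeffA, coeffB] <;> ring

theorem hasDerivWithinAt_mul_apply {W : ℝ → Mat2} {D : Mat2} {s : Set ℝ} {x : ℝ} (X : Mat2)
    (hW : ∀ i k, HasDerivWithinAt (fun y => W y i k) (D i k) s x) (i k : Fin 2) :
    HasDerivWithinAt (fun y => (X * W y) i k) ((X * D) i k) s x := by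
  simp only [Matrix.mul_apply, Fin.sum_univ_two]
  exact ((hW 0 k).const_mul _).add ((hW 1 k).const_mul _)

/-- A family in Arov gauge parametrized by the mass of its transfer matrices. -/
structure IsMassParametrized (S : Set ℝ) (𝔄 : ℂ → ℝ → Mat2) : Prop extends IsArovFamily S 𝔄 where
  logDiag_eq : ∀ x ∈ S, logDiag 𝔄 x = x

/-- The parameter `𝔞` of the canonical system solved by a family parametrized by its mass,
read off from the off-diagonal entry at `i`. -/
def schurParam (𝔄 : ℂ → ℝ → Mat2) (x : ℝ) : ℂ :=
  -(Real.exp (2 * x) / 2 : ℂ) * deriv (fun y => 𝔄 I y 1 0 * (Real.exp (-y) : ℂ)) x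

theorem measurable_schurParam (𝔄 : ℂ → ℝ → Mat2) : Measurable (schurParam 𝔄) := by
  unfold schurParam
  have hexp : Measurable fun x : ℝ => -(Real.exp (2 * x) / 2 : ℂ) := by fun_prop
  exact hexp.mul (measurable_deriv _)

namespace IsMassParametrized

variable {S : Set ℝ} {𝔄 : ℂ → ℝ → Mat2} {x : ℝ}

theorem apply_I_zero_zero_eq_exp (h : IsMassParametrized S 𝔄) (hx : x ∈ S) :
    𝔄 I x 0 0 = (Real.exp x : ℂ) := by
  rw [h.apply_I_zero_zero hx, h.logDiag_eq x hx]

theorem apply_I_one_one_eq_exp_neg (h : IsMassParametrized S 𝔄) (hx : x ∈ S) :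
    𝔄 I x 1 1 = (Real.exp (-x) : ℂ) := by
  rw [h.apply_I_one_one hx, h.logDiag_eq x hx]

theorem exists_lipschitzOnWith (h : IsMassParametrized S 𝔄) {a b : ℝ} (ha : a ∈ S) (hb : b ∈ S)
    (z : ℂ) (i k : Fin 2) : ∃ K, LipschitzOnWith K (fun x => 𝔄 z x i k) (Icc a b) := by
  refine ⟨_, LipschitzOnWith.of_dist_le' (K := 400 * max 1 ‖z‖ *
    Real.exp (162 * max 1 ‖z‖ * max |a| |b|)) fun x hx y hy => ?_⟩
  have hS := h.ordConnected.out ha hb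
  have hM : ∀ t ∈ Icc a b, |logDiag 𝔄 t| ≤ max |a| |b| := fun t ht => by
    rw [h.logDiag_eq t (hS ht)]
    exact abs_le_max_abs_abs ht.1 ht.2
  have hle := h.norm_apply_sub_apply_le (hS hy) (hS hx) (le_max_left 1 ‖z‖) (le_max_right 1 ‖z‖)
    (hM y hy) (hM x hx) i k
  rwa [h.logDiag_eq x (hS hx), h.logDiag_eq y (hS hy), ← dist_eq_norm, ← Real.dist_eq] at hle

theorem ae_differentiableAt (h : IsMassParametrized S 𝔄) (z : ℂ) :
    ∀ᵐ x, x ∈ S → S ∈ 𝓝 x ∧ ∀ i k, DifferentiableAt ℝ (fun y => 𝔄 z y i k) x := by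
  refine ae_of_mem_of_ae_of_mem_inter_Ioo fun a b ha hb _ => ?_
  have hdiff : ∀ i k, ∀ᵐ x, x ∈ Icc a b →
      DifferentiableWithinAt ℝ (fun y => 𝔄 z y i k) (Icc a b) x := fun i k =>
    (h.exists_lipschitzOnWith ha hb z i k).choose_spec.ae_differentiableWithinAt_of_mem
  filter_upwards [ae_all_iff.2 fun i => ae_all_iff.2 (hdiff i)] with x hx hxab
  have hnhds : Icc a b ∈ 𝓝 x := Icc_mem_nhds hxab.2.1 hxab.2.2
  exact ⟨mem_of_superset hnhds (h.ordConnected.out ha hb), fun i k =>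
    (hx i k (Ioo_subset_Icc_self hxab.2)).differentiableAt hnhds⟩

theorem hasDerivAt_transfer_I (h : IsMassParametrized S 𝔄) (hS : S ∈ 𝓝 x)
    (hd : DifferentiableAt ℝ (fun y => 𝔄 I y 1 0) x) (i k : Fin 2) :
    HasDerivAt (fun y => transfer 𝔄 x y I i k) (!![1, 0; -2 * schurParam 𝔄 x, -1] i k) x := by
  have hx : x ∈ S := mem_of_mem_nhds hS
  have hexp : HasDerivAt (fun y : ℝ => (Real.exp y : ℂ)) (Real.exp x) x :=
    (Real.hasDerivAt_exp x).ofReal_comp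
  have hexp_neg : HasDerivAt (fun y : ℝ => (Real.exp (-y) : ℂ)) (-Real.exp (-x) : ℝ) x := by
    simpa only [mul_neg, mul_one] using (hasDerivAt_neg x).exp.ofReal_comp
  have hinv : (Real.exp x : ℂ) * (Real.exp (-x) : ℂ) = 1 := by
    rw [← ofReal_mul, ← Real.exp_add, add_neg_cancel, Real.exp_zero, ofReal_one]
  have heq : (fun y => transfer 𝔄 x y I i k) =ᶠ[𝓝 x] fun y =>
      !![(Real.exp (-x) : ℂ) * Real.exp y, 0;
        Real.exp x * 𝔄 I y 1 0 - 𝔄 I x 1 0 * Real.exp y, Real.exp x * Real.exp (-y)] i k := by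
    filter_upwards [hS] with y hy
    rw [h.transfer_I hx hy, h.apply_I_zero_zero_eq_exp hx, h.apply_I_zero_zero_eq_exp hy,
      h.apply_I_one_one_eq_exp_neg hx, h.apply_I_one_one_eq_exp_neg hy]
  refine HasDerivAt.congr_of_eventuallyEq ?_ heq
  fin_cases i <;> fin_cases k
  · exact (hexp.const_mul _).congr_deriv ((mul_comm _ _).trans hinv)
  · exact hasDerivAt_const x 0
  · refine ((hd.hasDerivAt.const_mul _).sub (hexp.const_mul _)).congr_deriv ?_
    have htwo : (Real.exp (2 * x) : ℂ) = Real.exp x * Real.exp x := by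
      rw [two_mul, Real.exp_add, ofReal_mul]
    have hderiv : deriv (fun y => 𝔄 I y 1 0 * (Real.exp (-y) : ℂ)) x =
        deriv (fun y => 𝔄 I y 1 0) x * (Real.exp (-x) : ℂ) +
          𝔄 I x 1 0 * (-Real.exp (-x) : ℝ) := (hd.hasDerivAt.mul hexp_neg).deriv
    change _ = -2 * schurParam 𝔄 x
    rw [schurParam, hderiv, htwo, ofReal_neg]
    linear_combination (-(Real.exp x : ℂ) * deriv (fun y => 𝔄 I y 1 0) x +
      (Real.exp x : ℂ) * 𝔄 I x 1 0) * hinv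
  · exact (hexp_neg.const_mul _).congr_deriv (by
      rw [ofReal_neg, mul_neg, hinv]; rfl)

theorem norm_schurParam_le_one (h : IsMassParametrized S 𝔄) (hS : S ∈ 𝓝 x)
    (hd : DifferentiableAt ℝ (fun y => 𝔄 I y 1 0) x) : ‖schurParam 𝔄 x‖ ≤ 1 := by
  have hx : x ∈ S := mem_of_mem_nhds hS
  have h10 := ((h.hasDerivAt_transfer_I hS hd 1 0).hasDerivWithinAt (s := Ioi x))
  have h00 := ((h.hasDerivAt_transfer_I hS hd 0 0).hasDerivWithinAt (s := Ioi x))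
  rw [hasDerivWithinAt_iff_tendsto_slope' self_notMem_Ioi] at h10 h00
  have hle : ‖-2 * schurParam 𝔄 x‖ ≤ 2 * ‖(1 : ℂ)‖ := by
    refine le_of_tendsto_of_tendsto h10.norm (h00.norm.const_mul 2) ?_
    filter_upwards [self_mem_nhdsWithin, nhdsWithin_le_nhds hS] with y hxy hy
    have hW := h.isArovInner_transfer hx hy (le_of_lt hxy)
    have hbound : ‖transfer 𝔄 x y I 1 0‖ ≤ 2 * ‖transfer 𝔄 x y I 0 0 - 1‖ := by
      rw [hW.apply_I_zero_zero_eq_norm, ← ofReal_one, ← ofReal_sub, norm_real,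
        Real.norm_of_nonneg (sub_nonneg.2 (hW.one_le_norm (by simp)))]
      exact hW.norm_apply_I_one_zero_le
    simp only [slope_def_module, h.transfer_self hx, norm_smul, Matrix.one_apply_eq,
      Matrix.one_apply_ne one_ne_zero, sub_zero]
    rw [mul_left_comm]
    gcongr
  rw [norm_mul, norm_neg, RCLike.norm_ofNat, norm_one, mul_one] at hle
  linarith

theorem eventually_isArovInner_transfer (h : IsMassParametrized S 𝔄) (hS : S ∈ 𝓝 x) :
    ∀ᶠ y in 𝓝[≥] x, IsArovInner (transfer 𝔄 x y) ∧ mass (transfer 𝔄 x y) = y - x := by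
  have hx : x ∈ S := mem_of_mem_nhds hS
  filter_upwards [self_mem_nhdsWithin, nhdsWithin_le_nhds hS] with y hxy hy
  refine ⟨h.isArovInner_transfer hx hy hxy, ?_⟩
  rw [h.mass_transfer hx hy, h.logDiag_eq y hy, h.logDiag_eq x hx]

theorem hasDerivWithinAt_transfer_sub_interpolantAtI (h : IsMassParametrized S 𝔄) (hS : S ∈ 𝓝 x)
    (z : ℂ) (i k : Fin 2) :
    HasDerivWithinAt (fun y => (transfer 𝔄 x y z - 1) i k -
      interpolantAtI (fun v => (transfer 𝔄 x y v - 1) i k) z) 0 (Ici x) x := by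
  have hsmall (c : ℝ) : ∀ᶠ y in 𝓝[≥] x, c * (y - x) < 1 := by
    have hcont : Continuous fun y => c * (y - x) := by fun_prop
    exact nhdsWithin_le_nhds (hcont.continuousAt.eventually_lt continuousAt_const (by simp))
  have hbig : (fun y => (transfer 𝔄 x y z - 1) i k -
      interpolantAtI (fun v => (transfer 𝔄 x y v - 1) i k) z) =O[𝓝[≥] x]
        fun y => ‖y - x‖ ^ 2 := by
    refine Asymptotics.IsBigO.of_bound (128000 * ‖z ^ 2 + 1‖) ?_
    filter_upwards [h.eventually_isArovInner_transfer hS, hsmall 400, hsmall (200 * ‖z‖)]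
      with y ⟨hinner, hmass⟩ h1 h2
    rw [← hmass, mul_assoc] at h2
    have hle := hinner.norm_sub_one_sub_interpolantAtI_le (hmass ▸ h1.le) h2.le i k
    rw [hmass] at hle
    rw [norm_pow, norm_norm, Real.norm_eq_abs, sq_abs, mul_right_comm]
    exact hle
  exact (hbig.hasFDerivWithinAt (𝕜 := ℝ) self_mem_Ici one_lt_two).hasDerivWithinAt

theorem hasDerivWithinAt_transfer (h : IsMassParametrized S 𝔄) (hS : S ∈ 𝓝 x)
    (hd : DifferentiableAt ℝ (fun y => 𝔄 I y 1 0) x) (z : ℂ) (i k : Fin 2) :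
    HasDerivWithinAt (fun y => transfer 𝔄 x y z i k)
      ((coeffM (schurParam 𝔄) z x * jMat) i k) (Ici x) x := by
  set D : Mat2 := !![1, 0; -2 * schurParam 𝔄 x, -1] with hD
  have hI (i k : Fin 2) :
      HasDerivWithinAt (fun y => (transfer 𝔄 x y I - 1) i k) (D i k) (Ici x) x :=
    ((h.hasDerivAt_transfer_I hS hd i k).sub_const _).hasDerivWithinAt
  have hneg : HasDerivWithinAt (fun y => (transfer 𝔄 x y (-I) - 1) i k) (star (D i.rev k.rev))
      (Ici x) x := by
    refine (hI i.rev k.rev).star.congr_of_eventuallyEq_of_mem ?_ self_mem_Ici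
    filter_upwards [h.eventually_isArovInner_transfer hS] with y hy
    rw [← hy.1.sub_one_apply_star, star_def, conj_I]
  have hinterp : HasDerivWithinAt
      (fun y => interpolantAtI (fun v => (transfer 𝔄 x y v - 1) i k) z)
      ((coeffM (schurParam 𝔄) z x * jMat) i k) (Ici x) x := by
    refine (((hI i k).const_mul _).add (hneg.const_mul _)).congr_deriv ?_
    rw [coeffM_eq, hD]
    fin_cases i <;> fin_cases k <;> simp [jMat, Matrix.mul_apply] <;> ring
  have hrem := h.hasDerivWithinAt_transfer_sub_interpolantAtI hS z i k
  refine ((hrem.add hinterp).congr_deriv (zero_add _)).add_const ((1 : Mat2) i k) |>.congr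
    (fun y _ => ?_) ?_
  all_goals simp only [Pi.add_apply, sub_add_cancel, Matrix.sub_apply]

theorem hasRNDeriv (h : IsMassParametrized S 𝔄) (z : ℂ) :
    HasRNDeriv S volume (𝔄 z) fun x => 𝔄 z x * (coeffM (schurParam 𝔄) z x * jMat) := by
  refine hasRNDeriv_iff.2 fun i k => hasScalarRNDeriv_volume_of_lipschitzOnWith h.ordConnected
    (fun a ha b hb => h.exists_lipschitzOnWith ha hb z i k) ?_
  filter_upwards [h.ae_differentiableAt z, h.ae_differentiableAt I] with x hz hI hx
  obtain ⟨hS, hdI⟩ := hI hx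
  have hderiv := hasDerivWithinAt_mul_apply (𝔄 z x) (h.hasDerivWithinAt_transfer hS (hdI 1 0) z) i k
  simp only [h.mul_transfer hx] at hderiv
  exact (uniqueDiffOn_Ici x x self_mem_Ici).eq_deriv _ ((hz hx).2 i k).hasDerivAt.hasDerivWithinAt
    hderiv

theorem ae_norm_schurParam_le_one (h : IsMassParametrized S 𝔄) :
    ∀ᵐ x ∂volume.restrict S, ‖schurParam 𝔄 x‖ ≤ 1 := by
  refine (ae_restrict_iff' h.ordConnected.measurableSet).2 ?_
  filter_upwards [h.ae_differentiableAt I] with x hI hx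
  exact h.norm_schurParam_le_one (hI hx).1 ((hI hx).2 1 0)

end IsMassParametrized

/-- The family reparametrized by its mass, i.e. by the value of `logDiag`. -/
def massParam (S : Set ℝ) (𝔄 : ℂ → ℝ → Mat2) (z : ℂ) (x : ℝ) : Mat2 :=
  𝔄 z (Function.invFunOn (logDiag 𝔄) S x)

namespace IsArovFamily

variable {S : Set ℝ} {𝔄 : ℂ → ℝ → Mat2}

theorem massParam_logDiag (h : IsArovFamily S 𝔄) {t : ℝ} (ht : t ∈ S) (z : ℂ) :
    massParam S 𝔄 z (logDiag 𝔄 t) = 𝔄 z t := by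
  have hx := mem_image_of_mem (logDiag 𝔄) ht
  exact h.apply_eq_of_logDiag_eq (Function.invFunOn_mem hx) ht (Function.invFunOn_eq hx) z

theorem isContinuousFamily_massParam (h : IsArovFamily S 𝔄) :
    IsContinuousFamily (logDiag 𝔄 '' S) (massParam S 𝔄) := by
  intro z
  refine continuousOn_pi.2 fun i => continuousOn_pi.2 fun k => LocallyLipschitzOn.continuousOn ?_
  intro x _
  refine ⟨_, _, inter_mem_nhdsWithin _ (Icc_mem_nhds (sub_one_lt x) (lt_add_one x)),
    LipschitzOnWith.of_dist_le' (K := 400 * max 1 ‖z‖ *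
      Real.exp (162 * max 1 ‖z‖ * max |x - 1| |x + 1|)) ?_⟩
  rintro _ ⟨⟨s, hs, rfl⟩, hsx⟩ _ ⟨⟨t, ht, rfl⟩, htx⟩
  rw [h.massParam_logDiag hs, h.massParam_logDiag ht, dist_eq_norm, Real.dist_eq]
  exact h.norm_apply_sub_apply_le ht hs (le_max_left 1 ‖z‖) (le_max_right 1 ‖z‖)
    (abs_le_max_abs_abs htx.1 htx.2) (abs_le_max_abs_abs hsx.1 hsx.2) i k

theorem isMassParametrized_massParam (h : IsArovFamily S 𝔄) :
    IsMassParametrized (logDiag 𝔄 '' S) (massParam S 𝔄) where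
  ordConnected := ordConnected_image h.ordConnected h.continuousOn_logDiag
  zero_mem := ⟨0, h.zero_mem, h.logDiag_zero⟩
  mono := fun x hx y hy hxy => h.mono _ (Function.invFunOn_mem hx) _ (Function.invFunOn_mem hy)
    (strictMonoOn_invFunOn h.monotoneOn_logDiag hx hy hxy)
  cont := h.isContinuousFamily_massParam
  gauge := fun _ hx => h.gauge _ (Function.invFunOn_mem hx)
  det := fun z _ hx => h.det z _ (Function.invFunOn_mem hx)
  apply_zero := fun z => by
    rw [← h.logDiag_zero, h.massParam_logDiag h.zero_mem, h.apply_zero]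
  logDiag_eq := fun _ hx => Function.invFunOn_eq hx

end IsArovFamily

theorem posSemidef_coeffA_iff {𝔞 : ℝ → ℂ} {t : ℝ} : (coeffA 𝔞 t).PosSemidef ↔ ‖𝔞 t‖ ≤ 1 := by
  have hsq : star (𝔞 t) * 𝔞 t = (‖𝔞 t‖ ^ 2 : ℝ) := by
    rw [mul_comm, star_def, mul_conj, normSq_eq_norm_sq]
  refine ⟨fun h => ?_, fun h => ?_⟩
  · have hdet : (coeffA 𝔞 t).det = (1 - ‖𝔞 t‖ ^ 2 : ℝ) := by
      rw [ofReal_sub, ← hsq]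
      simp [coeffA, Matrix.det_fin_two]
    have hnonneg := h.det_nonneg
    rw [hdet, zero_le_real, sub_nonneg] at hnonneg
    exact (sq_le_one_iff₀ (norm_nonneg _)).1 hnonneg
  · have hsum : coeffA 𝔞 t = Matrix.diagonal ![((1 - ‖𝔞 t‖ ^ 2 : ℝ) : ℂ), 0] +
        Matrix.vecMulVec ![-star (𝔞 t), 1] (star ![-star (𝔞 t), 1]) := by
      rw [ofReal_sub, ← hsq]
      ext i k
      rw [Matrix.add_apply, Matrix.vecMulVec_apply, coeffA]
      fin_cases i <;> fin_cases k <;> simp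
    rw [hsum]
    refine (Matrix.posSemidef_diagonal_iff.2 fun i => ?_).add
      (Matrix.posSemidef_vecMulVec_self_star _)
    fin_cases i
    · exact zero_le_real.2 (sub_nonneg.2 (pow_le_one₀ (norm_nonneg _) h))
    · exact le_rfl

theorem solvesCanonicalSystem_iff {S : Set ℝ} {μ : Measure ℝ} {𝔞 : ℝ → ℂ} {𝔄 : ℂ → ℝ → Mat2}
    (h0 : (0 : ℝ) ∈ S) (hinit : ∀ z, 𝔄 z 0 = 1) :
    SolvesCanonicalSystem S μ (coeffA 𝔞) (coeffB 𝔞) 𝔄 ↔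
      ∀ z, HasRNDeriv S μ (𝔄 z) fun t => 𝔄 z t * (coeffM 𝔞 z t * jMat) := by
  refine forall_congr' fun z => ⟨fun ⟨hint, heq⟩ => ?_, fun h => ?_⟩
  · have hjMat : HasRNDeriv S μ (fun t => 𝔄 z t * jMat) fun t => 𝔄 z t * coeffM 𝔞 z t := by
      refine ⟨hint, fun a ha b hb => ?_⟩
      have hii (t : ℝ) (ht : t ∈ S) (i k : Fin 2) :
          IntervalIntegrable (fun ξ => (𝔄 z ξ * coeffM 𝔞 z ξ) i k) μ 0 t :=
        ⟨(hint 0 h0 t ht i k).mono_set Ioc_subset_Icc_self,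
          (hint t ht 0 h0 i k).mono_set Ioc_subset_Icc_self⟩
      beta_reduce
      rw [heq b hb, heq a ha, add_sub_add_left_eq_sub]
      ext i k
      exact intervalIntegral.integral_interval_sub_left (hii b hb i k) (hii a ha i k)
    simpa only [mul_assoc, jMat_mul_jMat, mul_one] using hjMat.mul_jMat
  · have hjMat := h.mul_jMat
    simp only [mul_assoc, jMat_mul_jMat, mul_one] at hjMat
    refine ⟨hjMat.1, fun t ht => ?_⟩
    have hsub := hjMat.2 0 h0 t ht
    beta_reduce at hsub
    rw [hinit, one_mul, sub_eq_iff_eq_add'] at hsub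
    exact hsub

theorem isArovSolution_of_hasRNDeriv {S : Set ℝ} {μ : Measure ℝ} {𝔞 : ℝ → ℂ} {𝔄 : ℂ → ℝ → Mat2}
    (hμ : IsContinuousMeasure S μ) (h𝔞 : AEStronglyMeasurable 𝔞 μ) (hle : ∀ᵐ t ∂μ, ‖𝔞 t‖ ≤ 1)
    (h0 : (0 : ℝ) ∈ S) (hinit : ∀ z, 𝔄 z 0 = 1)
    (hderiv : ∀ z, HasRNDeriv S μ (𝔄 z) fun t => 𝔄 z t * (coeffM 𝔞 z t * jMat)) :
    IsArovSolution S μ 𝔞 𝔄 := by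
  have hint (a : ℝ) (ha : a ∈ S) (b : ℝ) (hb : b ∈ S) : IntegrableOn 𝔞 (Icc a b) μ :=
    Measure.integrableOn_of_bounded (hμ.finite a ha b hb).ne h𝔞 (ae_restrict_of_ae hle)
  have hstar (a : ℝ) (ha : a ∈ S) (b : ℝ) (hb : b ∈ S) :
      IntegrableOn (fun t => star (𝔞 t)) (Icc a b) μ :=
    conjCLE.toContinuousLinearMap.integrable_comp (hint a ha b hb)
  have hconst (a : ℝ) (ha : a ∈ S) (b : ℝ) (hb : b ∈ S) (c : ℂ) :
      IntegrableOn (fun _ => c) (Icc a b) μ := integrableOn_const (hμ.finite a ha b hb).ne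
  exact
    { system :=
      { carried := hμ.carried
        continuous := hμ.singleton
        finite := hμ.finite
        locInt_P := fun a ha b hb i k => by
          fin_cases i <;> fin_cases k
          exacts [hconst a ha b hb 1, (hstar a ha b hb).neg, (hint a ha b hb).neg,
            hconst a ha b hb 1]
        locInt_Q := fun a ha b hb i k => by
          fin_cases i <;> fin_cases k
          exacts [hconst a ha b hb 0, hstar a ha b hb, (hint a ha b hb).neg, hconst a ha b hb 0]
        nonneg := hle.mono fun t => posSemidef_coeffA_iff.2
        skew := ae_of_all _ fun t => by
          ext i k
          fin_cases i <;> fin_cases k <;> simp [coeffB]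
        trace_P := ae_of_all _ fun t => by simp [jMat, coeffA, Matrix.trace_fin_two]
        trace_Q := ae_of_all _ fun t => by simp [jMat, coeffB, Matrix.trace_fin_two] }
      gauge := ae_of_all _ fun t => by simp [coeffA, coeffB, Matrix.trace_fin_two]
      solves := (solvesCanonicalSystem_iff h0 hinit).2 hderiv }

theorem IsArovFamily.exists_isArovSolution {S : Set ℝ} {𝔄 : ℂ → ℝ → Mat2}
    (h : IsArovFamily S 𝔄) :
    ∃ (μ : Measure ℝ) (𝔞 : ℝ → ℂ), IsArovSolution S μ 𝔞 𝔄 := by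
  have hS := h.ordConnected
  have hm := h.monotoneOn_logDiag
  have hc := h.continuousOn_logDiag
  have hM := h.isMassParametrized_massParam
  have hμ := isContinuousMeasure_pullbackMeasure hS hc hm
  obtain ⟨hmeas, hmap⟩ := map_pullbackMeasure hS hc hm
  refine ⟨pullbackMeasure (logDiag 𝔄) S, fun t => schurParam (massParam S 𝔄) (logDiag 𝔄 t),
    isArovSolution_of_hasRNDeriv hμ ?_ ?_ h.zero_mem h.apply_zero fun z => ?_⟩
  · exact ((measurable_schurParam _).comp_aemeasurable hmeas).aestronglyMeasurable
  · have hle := hM.ae_norm_schurParam_le_one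
    rw [← hmap] at hle
    exact ae_of_ae_map hmeas hle
  · refine hasRNDeriv_iff.2 fun i k => ?_
    refine ((hasRNDeriv_iff.1 (hM.hasRNDeriv z) i k).comp hμ hS fun a ha b hb hab => ?_).congr ?_ ?_
    · rw [measureReal_def, pullbackMeasure_Icc hS hc hm ha hb,
        ENNReal.toReal_ofReal (sub_nonneg.2 (hm ha hb hab))]
    · exact fun t ht => by rw [h.massParam_logDiag ht]
    · filter_upwards [hμ.ae_mem] with t ht
      rw [h.massParam_logDiag ht]
      rfl

/-! ### Uniqueness of the parameters -/

theorem IsContinuousMeasure.measureReal_Icc_eq_distrib_sub {S : Set ℝ} {μ : Measure ℝ}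
    (hμ : IsContinuousMeasure S μ) (h0 : (0 : ℝ) ∈ S) {a b : ℝ} (ha : a ∈ S) (hb : b ∈ S)
    (hab : a ≤ b) : μ.real (Icc a b) = distrib μ b - distrib μ a := by
  have := hμ.nullSingletonClass
  have hdistrib (t : ℝ) : distrib μ t = ∫ _ in (0 : ℝ)..t, (1 : ℝ) ∂μ := by
    rw [distrib]
    split_ifs with ht
    · rw [intervalIntegral.integral_of_le ht, setIntegral_const, smul_eq_mul, mul_one,
        measureReal_congr Ico_ae_eq_Ioc]
    · rw [intervalIntegral.integral_of_ge (not_le.1 ht).le, setIntegral_const, smul_eq_mul,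
        mul_one, measureReal_congr Ico_ae_eq_Ioc]
  have hone (t : ℝ) (ht : t ∈ S) : IntervalIntegrable (fun _ => (1 : ℝ)) μ 0 t :=
    ⟨(integrableOn_const (hμ.finite 0 h0 t ht).ne).mono_set Ioc_subset_Icc_self,
      (integrableOn_const (hμ.finite t ht 0 h0).ne).mono_set Ioc_subset_Icc_self⟩
  rw [hdistrib, hdistrib, intervalIntegral.integral_interval_sub_left (hone b hb) (hone a ha),
    intervalIntegral.integral_of_le hab, setIntegral_const, smul_eq_mul, mul_one,
    measureReal_congr Ioc_ae_eq_Icc]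

theorem hasScalarRNDeriv_exp_neg (S : Set ℝ) :
    HasScalarRNDeriv S volume (fun x => (Real.exp (-x) : ℂ)) fun x => -(Real.exp (-x) : ℂ) := by
  have hc : Continuous fun x : ℝ => -(Real.exp (-x) : ℂ) := by fun_prop
  refine ⟨fun a _ b _ => hc.integrableOn_Icc, fun a _ b _ => ?_⟩
  have hderiv (x : ℝ) : HasDerivAt (fun y : ℝ => (Real.exp (-y) : ℂ)) (-(Real.exp (-x) : ℂ)) x := by
    simpa using (hasDerivAt_neg x).exp.ofReal_comp
  exact (intervalIntegral.integral_eq_sub_of_hasDerivAt (fun x _ => hderiv x)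
    (hc.intervalIntegrable a b)).symm

theorem distrib_zero (μ : Measure ℝ) : distrib μ 0 = 0 := by
  simp [distrib]

theorem coeffA_add_coeffB (𝔞 : ℝ → ℂ) (t : ℝ) :
    coeffA 𝔞 t + coeffB 𝔞 t = !![1, 0; -2 * 𝔞 t, 1] := by
  ext i k
  fin_cases i <;> fin_cases k <;> simp [coeffA, coeffB, two_mul]

theorem coeffM_I (𝔞 : ℝ → ℂ) (t : ℝ) : coeffM 𝔞 I t = -(coeffA 𝔞 t + coeffB 𝔞 t) := by
  rw [coeffM, I_mul_I, neg_one_smul, neg_add, sub_eq_add_neg]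

namespace IsArovSolution

variable {S : Set ℝ} {μ : Measure ℝ} {𝔞 : ℝ → ℂ} {𝔄 : ℂ → ℝ → Mat2} {t : ℝ}

theorem isContinuousMeasure (hs : IsArovSolution S μ 𝔞 𝔄) : IsContinuousMeasure S μ :=
  ⟨hs.system.carried, hs.system.continuous, hs.system.finite⟩

theorem ae_norm_le_one (hs : IsArovSolution S μ 𝔞 𝔄) : ∀ᵐ t ∂μ, ‖𝔞 t‖ ≤ 1 :=
  hs.system.nonneg.mono fun _ => posSemidef_coeffA_iff.1

theorem hasRNDeriv (hs : IsArovSolution S μ 𝔞 𝔄) (h : IsArovFamily S 𝔄) (z : ℂ) :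
    HasRNDeriv S μ (𝔄 z) fun t => 𝔄 z t * (coeffM 𝔞 z t * jMat) :=
  (solvesCanonicalSystem_iff h.zero_mem h.apply_zero).1 hs.solves z

theorem hasScalarRNDeriv_exp_neg_distrib (hs : IsArovSolution S μ 𝔞 𝔄) (h : IsArovFamily S 𝔄) :
    HasScalarRNDeriv S μ (fun t => (Real.exp (-distrib μ t) : ℂ))
      fun t => -(Real.exp (-distrib μ t) : ℂ) :=
  (hasScalarRNDeriv_exp_neg _).comp hs.isContinuousMeasure h.ordConnected fun _ ha _ hb =>
    hs.isContinuousMeasure.measureReal_Icc_eq_distrib_sub h.zero_mem ha hb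

theorem hasScalarRNDeriv_apply_I (hs : IsArovSolution S μ 𝔞 𝔄) (h : IsArovFamily S 𝔄) :
    HasScalarRNDeriv S μ (fun t => 𝔄 I t 0 0) (fun t => 𝔄 I t 0 0) ∧
      HasScalarRNDeriv S μ (fun t => 𝔄 I t 1 0)
        fun t => 𝔄 I t 1 0 - 2 * 𝔞 t * 𝔄 I t 1 1 := by
  have hD := hasRNDeriv_iff.1 (hs.hasRNDeriv h I)
  have hcoeff (i : Fin 2) (t : ℝ) : (𝔄 I t * (coeffM 𝔞 I t * jMat)) i 0 =
      𝔄 I t i 0 - 2 * 𝔞 t * 𝔄 I t i 1 := by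
    have hdiag : coeffM 𝔞 I t 0 0 = -1 := by simp [coeffM_I, coeffA_add_coeffB]
    have hoffDiag : coeffM 𝔞 I t 1 0 = 2 * 𝔞 t := by simp [coeffM_I, coeffA_add_coeffB]
    have hj : jMat 0 0 = -1 := rfl
    rw [Matrix.mul_apply, Fin.sum_univ_two, mul_jMat_apply, mul_jMat_apply, hdiag, hoffDiag, hj]
    ring
  refine ⟨(hD 0 0).congr (fun _ _ => rfl) ?_, (hD 1 0).congr (fun _ _ => rfl) ?_⟩
  · filter_upwards [hs.isContinuousMeasure.ae_mem] with t ht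
    rw [hcoeff, (h.gauge t ht).1, mul_zero, sub_zero]
  · exact ae_of_all _ (hcoeff 1)

theorem distrib_eq (hs : IsArovSolution S μ 𝔞 𝔄) (h : IsArovFamily S 𝔄) (ht : t ∈ S) :
    distrib μ t = logDiag 𝔄 t := by
  have hprod := ((hs.hasScalarRNDeriv_apply_I h).1.mul (hs.hasScalarRNDeriv_exp_neg_distrib h)
    hs.isContinuousMeasure h.ordConnected).sub_eq 0 h.zero_mem t ht
  simp only [neg_mul, mul_comm (𝔄 I _ 0 0), add_neg_cancel, intervalIntegral.integral_zero,
    h.apply_zero, distrib_zero, neg_zero, Real.exp_zero, ofReal_one, Matrix.one_apply_eq,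
    mul_one, sub_eq_zero, h.apply_I_zero_zero ht, ← ofReal_mul, ← Real.exp_add] at hprod
  have := Real.exp_eq_one_iff _ |>.1 (ofReal_eq_one.1 hprod)
  linarith

theorem hasScalarRNDeriv_apply_I_one_zero_mul_exp_neg (hs : IsArovSolution S μ 𝔞 𝔄)
    (h : IsArovFamily S 𝔄) :
    HasScalarRNDeriv S μ (fun t => 𝔄 I t 1 0 * (Real.exp (-distrib μ t) : ℂ))
      fun t => -(2 * 𝔞 t * (Real.exp (-2 * distrib μ t) : ℂ)) := by
  refine ((hs.hasScalarRNDeriv_apply_I h).2.mul (hs.hasScalarRNDeriv_exp_neg_distrib h)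
    hs.isContinuousMeasure h.ordConnected).congr (fun _ _ => rfl) ?_
  filter_upwards [hs.isContinuousMeasure.ae_mem] with t ht
  have hexp : Real.exp (-2 * distrib μ t) = Real.exp (-distrib μ t) * Real.exp (-distrib μ t) := by
    rw [← Real.exp_add]
    ring_nf
  rw [h.apply_I_one_one ht, ← hs.distrib_eq h ht, hexp, ofReal_mul]
  ring

theorem intervalIntegrable_kappa (hs : IsArovSolution S μ 𝔞 𝔄) (h : IsArovFamily S 𝔄)
    (ht : t ∈ S) :
    IntervalIntegrable (fun l => 2 * 𝔞 l * (Real.exp (-2 * distrib μ l) : ℂ)) μ 0 t := by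
  have hint := (hs.hasScalarRNDeriv_apply_I_one_zero_mul_exp_neg h).integrableOn
  exact neg_neg (fun l => 2 * 𝔞 l * (Real.exp (-2 * distrib μ l) : ℂ)) ▸
    IntervalIntegrable.neg ⟨(hint 0 h.zero_mem t ht).mono_set Ioc_subset_Icc_self,
      (hint t ht 0 h.zero_mem).mono_set Ioc_subset_Icc_self⟩

theorem apply_I_eq (hs : IsArovSolution S μ 𝔞 𝔄) (h : IsArovFamily S 𝔄) (ht : t ∈ S) :
    𝔄 I t = !![(Real.exp (distrib μ t) : ℂ), 0;
      -(Real.exp (distrib μ t) : ℂ) * kappa μ 𝔞 t, (Real.exp (-distrib μ t) : ℂ)] := by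
  have hkappa : 𝔄 I t 1 0 * (Real.exp (-distrib μ t) : ℂ) = -kappa μ 𝔞 t := by
    have hsub := (hs.hasScalarRNDeriv_apply_I_one_zero_mul_exp_neg h).sub_eq 0 h.zero_mem t ht
    rwa [h.apply_zero, Matrix.one_apply_ne one_ne_zero, zero_mul, sub_zero,
      intervalIntegral.integral_neg] at hsub
  have hoffDiag : 𝔄 I t 1 0 = -(Real.exp (distrib μ t) : ℂ) * kappa μ 𝔞 t := by
    rw [neg_mul_comm, ← hkappa, mul_left_comm, ← ofReal_mul, ← Real.exp_add, add_neg_cancel,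
      Real.exp_zero, ofReal_one, mul_one]
  rw [← hoffDiag, hs.distrib_eq h ht, ← h.apply_I_zero_zero ht, ← h.apply_I_one_one ht,
    ← (h.gauge t ht).1]
  exact Matrix.eta_fin_two _

theorem ae_eq_neg_inv_mul (hs : IsArovSolution S μ 𝔞 𝔄) (h : IsArovFamily S 𝔄) {D : ℝ → Mat2}
    (hD : HasRNDeriv S μ (𝔄 I) D) :
    ∀ᵐ t ∂μ, coeffA 𝔞 t + coeffB 𝔞 t = -((𝔄 I t)⁻¹ * D t * jMat) := by
  have hμ := hs.isContinuousMeasure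
  filter_upwards [hμ.ae_mem, hD.ae_eq (hs.hasRNDeriv h I) hμ h.ordConnected] with t ht hDt
  rw [hDt, Matrix.nonsing_inv_mul_cancel_left _ _ (h.det I t ht ▸ isUnit_one), mul_assoc,
    jMat_mul_jMat, mul_one, coeffM_I, neg_neg]

end IsArovSolution

end Arov

end

theorem theorem1p1 (S : Set ℝ) (hS : S.OrdConnected) (h0 : (0 : ℝ) ∈ S)
    (𝔄 : ℂ → ℝ → Arov.Mat2)
    (hmono : Arov.IsJMonotonic Arov.jMat S 𝔄)
    (hcont : Arov.IsContinuousFamily S 𝔄)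
    (hgauge : Arov.InArovGauge S 𝔄)
    (hdet : ∀ z, ∀ ℓ ∈ S, (𝔄 z ℓ).det = 1)
    (hinit : ∀ z, 𝔄 z 0 = 1) :
    -- the family solves a canonical system in Arov gauge
    (∃ (μ : MeasureTheory.Measure ℝ) (𝔞 : ℝ → ℂ), Arov.IsArovSolution S μ 𝔞 𝔄) ∧
    -- the (2,2) entry at `i` is decreasing
    AntitoneOn (fun ℓ => (𝔄 Complex.I ℓ 1 1).re) S ∧
    -- the parameters of any such system are determined as follows
    ∀ (μ : MeasureTheory.Measure ℝ) (𝔞 : ℝ → ℂ), Arov.IsArovSolution S μ 𝔞 𝔄 →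
      (∀ ℓ ∈ S, Arov.distrib μ ℓ = Real.log (𝔄 Complex.I ℓ 0 0).re ∧
        Arov.distrib μ ℓ = -Real.log (𝔄 Complex.I ℓ 1 1).re) ∧
      (∃ D, Arov.HasRNDeriv S μ (𝔄 Complex.I) D) ∧
      (∀ D, Arov.HasRNDeriv S μ (𝔄 Complex.I) D →
        ∀ᵐ ℓ ∂μ,
          Arov.coeffA 𝔞 ℓ + Arov.coeffB 𝔞 ℓ = !![1, 0; -2 * 𝔞 ℓ, 1] ∧
          !![1, 0; -2 * 𝔞 ℓ, 1] = -((𝔄 Complex.I ℓ)⁻¹ * D ℓ * Arov.jMat)) ∧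
      (∀ᵐ ℓ ∂μ, ‖𝔞 ℓ‖ ≤ 1) ∧
      (∀ ℓ ∈ S,
        IntervalIntegrable
          (fun l => 2 * 𝔞 l * (Real.exp (-2 * Arov.distrib μ l) : ℂ)) μ 0 ℓ ∧
        𝔄 Complex.I ℓ =
          !![(Real.exp (Arov.distrib μ ℓ) : ℂ), 0;
             -(Real.exp (Arov.distrib μ ℓ) : ℂ) * Arov.kappa μ 𝔞 ℓ,
             (Real.exp (-Arov.distrib μ ℓ) : ℂ)]) := by
  have h : Arov.IsArovFamily S 𝔄 := ⟨hS, h0, hmono, hcont, hgauge, hdet, hinit⟩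
  refine ⟨h.exists_isArovSolution, h.antitoneOn_apply_I_one_one, fun μ 𝔞 hs =>
    ⟨fun ℓ hℓ => ⟨hs.distrib_eq h hℓ, ?_⟩, ⟨_, hs.hasRNDeriv h Complex.I⟩, fun D hD => ?_,
      hs.ae_norm_le_one, fun ℓ hℓ => ⟨hs.intervalIntegrable_kappa h hℓ, hs.apply_I_eq h hℓ⟩⟩⟩
  · rw [hs.distrib_eq h hℓ, h.apply_I_one_one hℓ, Complex.ofReal_re, Real.log_exp, neg_neg]
  · filter_upwards [hs.ae_eq_neg_inv_mul h hD] with ℓ hℓ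
    have hsum := Arov.coeffA_add_coeffB 𝔞 ℓ
    exact ⟨hsum, hsum.symm.trans hℓ⟩
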